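/- Let $a>-1$ and $\theta>0$. For $N\ge 0$ put \[ Z_N^{B}=\frac1{N!}\int_{\mathbb R_+^N}\prod_{1\le j<k\le N}\frac{x_k-x_j}{x_k+x_j}\,(x_k^\theta-x_j^\theta)\prod_{j=1}^N x_j^a e^{-x_j}\,dx_j , \] \[ Z_N^{C}=\frac1{(N!)^2}\int_{\mathbb R_+^N\times\mathbb R_+^N}\prod_{j=1}^N x_j^a e^{-x_j}y_j^{a+1}e^{-y_j}\, \frac{\prod_{j<k}(x_k-x_j)(y_k-y_j)}{\prod_{j,k=1}^N(x_j+y_k)}\prod_{j<k}(x_k^\theta-x_j^\theta)(y_k^\theta-y_j^\theta)\,d[x]\,d[y], \] so $Z_0^B=Z_0^C=1$. For $j,k\ge 0$ let \[ I^C_{j,k}=\int_{\mathbb R_+^2}\frac{x^{j\theta+a}y^{k\theta+a+1}}{x+y}e^{-(x+y)}\,dx\,dy,\qquad i^B_j=\int_{\mathbb R_+}x^{j\theta+a}e^{-x}\,dx . \] The monic $\theta$-Cauchy bi-orthogonal polynomials are \[ \tilde P_n(x)=\frac1{Z_n^C}\det\bigl(I^C_{j,k}\;\; x^j\bigr)_{\substack{j=0,\dots,n\\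 k=0,\dots,n-1}},\qquad \tilde Q_n(y)=\frac1{Z_n^C}\det\begin{pmatrix}I^C_{j,k}\\ y^k\end{pmatrix}_{\substack{j=0,\dots,n-1\\ k=0,\dots,n}} , \] where $x^j$ forms the last column and $y^k$ the last row, respectively. For real polynomials $p,q$ let \[ \langle p,q\rangle_{B}=\int_{\mathbb R_+^2}\frac{y-x}{y+x}\,p(x^\theta)\,q(y^\theta)\,x^a y^a e^{-(x+y)}\,dx\,dy . \] There is exactly one sequence $(\phi_n)_{n\ge0}$ of real polynomials (the $\theta$-Bures, or partial-skew-orthogonal, polynomials) such that $\phi_n$ is monic of degree $n$ and, for all $n\ge 0$ and $0\le i\le 2n+1$, \[ \langle \phi_{2n},z^i\rangle_B=\frac{Z^B_{2n+2}}{Z^B_{2n}}\,\delta_{i,2n+1},\qquad \langle \phi_{2n+1},z^i\rangle_B=-\frac{Z^B_{2n+2}}{Z^B_{2n+1}}\,i^B_i , \] and the following identities of polynomials hold: \begin{enumerate} \item $\tilde P_n(x)+\tilde Q_n(x)=2\phi_n(x)$ for all $n\ge 0$; \item $\tilde Q_n(x)=\phi_n(x)-\dfrac{Z_{n+1}^BZ_{n-1}^B}{(Z_n^B)^2}\,\phi_{n-1}(x)$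 for all $n\ge1$; \item $\tilde P_n(x)=\phi_n(x)+\dfrac{Z_{n+1}^BZ_{n-1}^B}{(Z_n^B)^2}\,\phi_{n-1}(x)$ for all $n\ge1$. \end{enumerate} -/

import Mathlib

open Polynomial MeasureTheory

noncomputable section

namespace ThetaDeformed

/-- The open positive orthant of `ℝ^N`. -/
def orthant (N : ℕ) : Set (Fin N → ℝ) := {x | ∀ i, 0 < x i}

/-- The partition function of the `θ`-deformed Cauchy--Laguerre two-matrix model. -/
def cauchyPartition (a b θ : ℝ) (N : ℕ) : ℝ :=
  (1 / (N.factorial : ℝ)) ^ 2 *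
    ∫ z in orthant N ×ˢ orthant N,
      (∏ j, z.1 j ^ a * Real.exp (-z.1 j) * (z.2 j ^ b * Real.exp (-z.2 j))) *
      ((∏ j, ∏ k ∈ Finset.Ioi j, (z.1 k - z.1 j) * (z.2 k - z.2 j)) /
        ∏ j, ∏ k, (z.1 j + z.2 k)) *
      ∏ j, ∏ k ∈ Finset.Ioi j, (z.1 k ^ θ - z.1 j ^ θ) * (z.2 k ^ θ - z.2 j ^ θ)

/-- The partition function `Z_N^B(a;θ)` of the `θ`-deformed Bures ensemble. -/
def buresPartition (a θ : ℝ) (N : ℕ) : ℝ :=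
  1 / (N.factorial : ℝ) *
    ∫ x in orthant N,
      (∏ j, ∏ k ∈ Finset.Ioi j, (x k - x j) / (x k + x j) * (x k ^ θ - x j ^ θ)) *
      ∏ j, x j ^ a * Real.exp (-x j)

/-- The Cauchy moments `I^C_{j,k}` with parameters `(a, a + 1)`, indexed from `0`. -/
def cauchyMoment (a θ : ℝ) (j k : ℕ) : ℝ :=
  ∫ z in Set.Ioi (0 : ℝ) ×ˢ Set.Ioi (0 : ℝ),
    1 / (z.1 + z.2) * z.1 ^ (j * θ + a) * z.2 ^ (k * θ + a + 1) * Real.exp (-(z.1 + z.2))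

/-- The monic `θ`-Cauchy bi-orthogonal polynomial in the first variable: the determinant of
the moments `I^C_{j,k}` (`0 ≤ j ≤ n`, `0 ≤ k ≤ n - 1`) with last column `x^j`, over `Z_n^C`. -/
def cauchyP (a θ : ℝ) (n : ℕ) : ℝ[X] :=
  C (cauchyPartition a (a + 1) θ n)⁻¹ *
    (Matrix.of fun j k : Fin (n + 1) =>
      if (k : ℕ) < n then C (cauchyMoment a θ j k) else X ^ (j : ℕ)).det

/-- The monic `θ`-Cauchy bi-orthogonal polynomial in the second variable: the determinant of
the moments `I^C_{j,k}` (`0 ≤ j ≤ n - 1`, `0 ≤ k ≤ n`) with last row `y^k`, over `Z_n^C`. -/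
def cauchyQ (a θ : ℝ) (n : ℕ) : ℝ[X] :=
  C (cauchyPartition a (a + 1) θ n)⁻¹ *
    (Matrix.of fun j k : Fin (n + 1) =>
      if (j : ℕ) < n then C (cauchyMoment a θ j k) else X ^ (k : ℕ)).det

/-- The skew-symmetric Bures inner product of two polynomials. -/
def buresInner (a θ : ℝ) (p q : ℝ[X]) : ℝ :=
  ∫ z in Set.Ioi (0 : ℝ) ×ˢ Set.Ioi (0 : ℝ),
    (z.2 - z.1) / (z.2 + z.1) * p.eval (z.1 ^ θ) * q.eval (z.2 ^ θ) *
      z.1 ^ a * z.2 ^ a * Real.exp (-(z.1 + z.2))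

/-- The single Bures moments `i^B_j`, indexed from `0`. -/
def buresMoment (a θ : ℝ) (j : ℕ) : ℝ :=
  ∫ x in Set.Ioi (0 : ℝ), x ^ (j * θ + a) * Real.exp (-x)

/-- `φ` is the family of `θ`-Bures (partial-skew-orthogonal) polynomials: `φ n` is monic of
degree `n`, and the family satisfies the partial skew-orthogonality conditions. -/
structure IsThetaBures (a θ : ℝ) (φ : ℕ → ℝ[X]) : Prop where
  monic : ∀ n, (φ n).Monic
  natDegree_eq : ∀ n, (φ n).natDegree = n
  even : ∀ n i, i ≤ 2 * n + 1 →
    buresInner a θ (φ (2 * n)) (X ^ i) =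
      if i = 2 * n + 1 then buresPartition a θ (2 * n + 2) / buresPartition a θ (2 * n) else 0
  odd : ∀ n i, i ≤ 2 * n + 1 →
    buresInner a θ (φ (2 * n + 1)) (X ^ i) =
      -(buresPartition a θ (2 * n + 2) / buresPartition a θ (2 * n + 1)) * buresMoment a θ i

end ThetaDeformed

end

/-!
Lagrange interpolation at the points `-x_k` expands `∏ (y - x_k) / (y + x_k)` in partial fractions,
which expands Schur's product along its last variable. Integrated, this identity says that the
averages of Schur's product against `n` of the `n + 1` weighted monomials are, up to sign and
normalisation, the coefficients of the partial-skew-orthogonal polynomial `φ_n`.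

The two ensembles are tied together by `y / (x + y) = (1 + (y - x) / (y + x)) / 2`: with `β` the
functional of single moments and `B` the skew form of the Bures model, the Cauchy bimoment form is
`(β ⊗ β + B) / 2`. Skew-symmetry, `B(φ_n, φ_n) = 0` and `B(φ_n, φ_{n+1}) = -B(φ_{n+1}, φ_n)`,
determines `β(φ_n)`, and then `φ_n ± c_n φ_{n-1}` is checked to be orthogonal to all lower degrees
for the Cauchy form (sign `+`) and for its transpose (sign `-`). Cramer's rule identifies these with
the bordered determinants `P_n` and `Q_n`, whose normalisation `Z_n^C` is a determinant of moments
by Andréief's identity and Cauchy's determinant.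
-/

noncomputable section

namespace ThetaDeformed

open scoped Matrix

section SchurProduct

variable {K : Type*} [Field K]

/-- The skew-symmetric kernel `(y - x) / (y + x)` of the Bures ensemble. -/
def skewKernel (x y : K) : K := (y - x) / (y + x)

/-- Schur's product `∏_{j < k} (x_k - x_j) / (x_k + x_j)`, which is the Pfaffian of the matrix of
values `skewKernel (x j) (x k)` when the number of variables is even. -/
def schurProd {N : ℕ} (x : Fin N → K) : K :=
  ∏ j, ∏ k ∈ Finset.Ioi j, skewKernel (x j) (x k)

theorem skewKernel_swap (x y : K) : skewKernel x y = -skewKernel y x := by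
  unfold skewKernel
  rw [add_comm x y, ← neg_div, neg_sub]

theorem schurProd_comp_perm {N : ℕ} (x : Fin N → K) (σ : Equiv.Perm (Fin N)) :
    schurProd (fun j => x (σ j)) = (Equiv.Perm.sign σ : ℤ) * schurProd x :=
  Equiv.Perm.prod_Ioi_comp_eq_sign_mul_prod (R := K) σ
    (f := fun i j => skewKernel (x i) (x j)) fun _ _ => skewKernel_swap _ _

theorem schurProd_succ {n : ℕ} (x : Fin (n + 1) → K) :
    schurProd x = (∏ j, skewKernel (x 0) (x (Fin.succ j))) * schurProd fun j => x (Fin.succ j) := by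
  unfold schurProd
  rw [Fin.prod_univ_succ, Fin.prod_Ioi_zero]
  simp only [Fin.prod_Ioi_succ]

theorem schurProd_succAbove {n : ℕ} (x : Fin (n + 1) → K) (k : Fin (n + 1)) :
    schurProd x = (-1) ^ (n + k : ℕ) * schurProd (fun j => x (k.succAbove j)) *
      ∏ j, skewKernel (x (k.succAbove j)) (x k) := by
  have hperm := schurProd_comp_perm x k.cycleRange.symm
  rw [Equiv.Perm.sign_symm, Fin.sign_cycleRange, schurProd_succ] at hperm
  simp only [Fin.cycleRange_symm_zero, Fin.cycleRange_symm_succ, skewKernel_swap (x k),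
    Finset.prod_neg, Finset.card_univ, Fintype.card_fin, Units.val_pow_eq_pow_val, Units.val_neg,
    Units.val_one, Int.cast_pow, Int.cast_neg, Int.cast_one] at hperm
  have hsign : ((-1 : K) ^ (k : ℕ)) * (-1) ^ (k : ℕ) = 1 := by rw [← mul_pow]; simp
  rw [pow_add]
  linear_combination (-schurProd x) * hsign - (-1) ^ (k : ℕ) * hperm

theorem nodalWeight_neg_mul_prod_erase {ι : Type*} [DecidableEq ι] (s : Finset ι) (x : ι → K)
    (k : ι) : Lagrange.nodalWeight s (-x) k * ∏ j ∈ s.erase k, (-x k - x j) =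
      ∏ j ∈ s.erase k, (skewKernel (x j) (x k))⁻¹ := by
  rw [Lagrange.nodalWeight, ← Finset.prod_mul_distrib]
  refine Finset.prod_congr rfl fun j _ => ?_
  rw [skewKernel, inv_div, ← neg_div_neg_eq, div_eq_inv_mul, Pi.neg_apply, Pi.neg_apply]
  congr 2 <;> ring

theorem prod_skewKernel_eq_one_sub_sum {ι : Type*} [DecidableEq ι] {s : Finset ι} {x : ι → K}
    (hx : Set.InjOn x s) {y : K} (hy : ∀ k ∈ s, y + x k ≠ 0) :
    ∏ k ∈ s, skewKernel (x k) y =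
      1 - ∑ k ∈ s, (∏ j ∈ s.erase k, (skewKernel (x j) (x k))⁻¹) * (1 - skewKernel (x k) y) := by
  -- Lagrange interpolation of `∏ (Y - x_k) - ∏ (Y + x_k)`, which has degree `< #s`, at the `-x_k`.
  have hv : Set.InjOn (-x) s := fun i hi j hj h => hx hi hj (neg_injective h)
  have hyv : ∀ k ∈ s, y ≠ (-x) k := fun k hk h => hy k hk (by simp [h])
  have hdeg : (Lagrange.nodal s x - Lagrange.nodal s (-x)).degree < s.card := by
    refine (degree_sub_lt_left ?_ Lagrange.nodal_ne_zero ?_).trans_eq Lagrange.degree_nodal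
    · rw [Lagrange.degree_nodal, Lagrange.degree_nodal]
    · rw [Lagrange.nodal_monic.leadingCoeff, Lagrange.nodal_monic.leadingCoeff]
  have hterm : ∀ k ∈ s, Lagrange.nodalWeight s (-x) k * (y - (-x) k)⁻¹ *
      (Lagrange.nodal s x - Lagrange.nodal s (-x)).eval ((-x) k) =
      -((∏ j ∈ s.erase k, (skewKernel (x j) (x k))⁻¹) * (1 - skewKernel (x k) y)) := fun k hk => by
    have hkernel : 1 - skewKernel (x k) y = (y + x k)⁻¹ * (x k + x k) := by
      rw [skewKernel, one_sub_div (hy k hk), div_eq_inv_mul]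
      ring
    rw [eval_sub, Lagrange.eval_nodal_at_node hk, Lagrange.eval_nodal,
      ← Finset.mul_prod_erase s _ hk, ← nodalWeight_neg_mul_prod_erase, hkernel, Pi.neg_apply,
      sub_neg_eq_add]
    ring
  have hpoly := congrArg (eval y) (Lagrange.eq_interpolate hv hdeg)
  rw [Lagrange.eval_interpolate_not_at_node _ hyv, Finset.sum_congr rfl hterm, eval_sub,
    Lagrange.eval_nodal, Lagrange.eval_nodal, Finset.sum_neg_distrib] at hpoly
  simp only [Pi.neg_apply, sub_neg_eq_add] at hpoly
  have hprod : ∏ k ∈ s, skewKernel (x k) y = (∏ k ∈ s, (y - x k)) / ∏ k ∈ s, (y + x k) :=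
    Finset.prod_div_distrib _ _
  rw [hprod, div_eq_iff (Finset.prod_ne_zero_iff.2 hy)]
  linear_combination hpoly

theorem schurProd_comp_succAbove {n : ℕ} {x : Fin (n + 1) → K} (hx : Function.Injective x)
    (h0 : ∀ i j, x i + x j ≠ 0) (k : Fin (n + 1)) :
    (-1) ^ (n + k : ℕ) * schurProd (fun j => x (k.succAbove j)) =
      schurProd x * ∏ j ∈ Finset.univ.erase k, (skewKernel (x j) (x k))⁻¹ := by
  have herase : Finset.univ.erase k = Finset.univ.map k.succAboveEmb := by
    ext j
    simp [Fin.exists_succAbove_eq_iff]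
  have hprod : ∏ j, skewKernel (x (k.succAbove j)) (x k) ≠ 0 :=
    Finset.prod_ne_zero_iff.2 fun j _ =>
      div_ne_zero (sub_ne_zero.2 fun h => k.succAbove_ne j (hx h).symm) (h0 _ _)
  rw [herase, Finset.prod_map, Finset.prod_inv_distrib, schurProd_succAbove x k]
  exact (mul_inv_cancel_right₀ hprod _).symm

theorem two_mul_sum_prod_inv_skewKernel {ι : Type*} [DecidableEq ι] {s : Finset ι} {x : ι → K}
    (hx : Set.InjOn x s) (h0 : ∀ k ∈ s, x k ≠ 0) :
    2 * ∑ k ∈ s, ∏ j ∈ s.erase k, (skewKernel (x j) (x k))⁻¹ = 1 - (-1) ^ s.card := by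
  have hkernel : ∀ k ∈ s, skewKernel (x k) 0 = -1 := fun k hk => by
    rw [skewKernel, zero_sub, zero_add, neg_div, div_self (h0 k hk)]
  have h := prod_skewKernel_eq_one_sub_sum hx (y := 0) fun k hk => by simpa using h0 k hk
  rw [Finset.prod_congr rfl hkernel, Finset.prod_const,
    Finset.sum_congr rfl fun k hk => by rw [hkernel k hk], ← Finset.sum_mul] at h
  linear_combination h

theorem sum_schurProd_succAbove_mul_skewKernel {n : ℕ} {x : Fin (n + 2) → K}
    (hx : Function.Injective x) (h0 : ∀ i j, x i + x j ≠ 0) :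
    ∑ k : Fin (n + 1), (-1) ^ (n + k : ℕ) * schurProd (fun j => x (k.succAbove j).castSucc) *
        skewKernel (x k.castSucc) (x (Fin.last (n + 1))) =
      schurProd x - if Even n then 0 else schurProd fun j => x (Fin.castSucc j) := by
  have hx' : Function.Injective fun j : Fin (n + 1) => x j.castSucc :=
    hx.comp (Fin.castSucc_injective _)
  have hfrac := prod_skewKernel_eq_one_sub_sum hx'.injOn (s := Finset.univ)
    fun k _ => h0 (Fin.last (n + 1)) k.castSucc
  have hres := two_mul_sum_prod_inv_skewKernel hx'.injOn (s := Finset.univ)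
    fun k _ h => h0 k.castSucc k.castSucc (by rw [h, add_zero])
  have h2 : (2 : K) ≠ 0 := fun h => h0 0 0 (by rw [← two_mul, h, zero_mul])
  have hsplit := schurProd_succAbove x (Fin.last (n + 1))
  simp only [Fin.succAbove_last, Fin.val_last, Even.neg_one_pow ⟨n + 1, rfl⟩, one_mul] at hsplit
  rw [Finset.sum_congr rfl fun k _ => by
    rw [schurProd_comp_succAbove hx' (fun _ _ => h0 _ _) k], hsplit, hfrac]
  simp only [mul_sub, mul_one, Finset.sum_sub_distrib, mul_assoc, ← Finset.mul_sum]
  rw [Finset.card_univ, Fintype.card_fin, pow_succ] at hres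
  apply mul_left_cancel₀ h2
  split_ifs with hn
  · rw [hn.neg_one_pow] at hres
    linear_combination schurProd (fun j : Fin (n + 1) => x j.castSucc) * hres
  · rw [(Nat.not_even_iff_odd.1 hn).neg_one_pow] at hres
    linear_combination schurProd (fun j : Fin (n + 1) => x j.castSucc) * hres

end SchurProduct

section SchurMoment

theorem abs_skewKernel_le_one {x y : ℝ} (hx : 0 < x) (hy : 0 < y) : |skewKernel x y| ≤ 1 := by
  rw [skewKernel, abs_div, abs_of_pos (add_pos hy hx), div_le_one (add_pos hy hx), abs_le]
  constructor <;> linarith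

theorem abs_schurProd_le_one {N : ℕ} {x : Fin N → ℝ} (hx : ∀ i, 0 < x i) :
    |schurProd x| ≤ 1 := by
  simp only [schurProd, Finset.abs_prod]
  exact Finset.prod_le_one (fun _ _ => Finset.prod_nonneg fun _ _ => abs_nonneg _) fun i _ =>
    Finset.prod_le_one (fun _ _ => abs_nonneg _) fun j _ => abs_skewKernel_le_one (hx i) (hx j)

@[fun_prop]
theorem measurable_skewKernel : Measurable fun p : ℝ × ℝ => skewKernel p.1 p.2 := by
  unfold skewKernel
  fun_prop

@[fun_prop]
theorem measurable_schurProd {N : ℕ} : Measurable (schurProd : (Fin N → ℝ) → ℝ) := by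
  unfold schurProd skewKernel
  fun_prop

theorem integral_pi_comp_perm {α ι E : Type*} [MeasurableSpace α] (μ : Measure α) [SigmaFinite μ]
    [Fintype ι] [NormedAddCommGroup E] [NormedSpace ℝ E] (σ : Equiv.Perm ι) (F : (ι → α) → E) :
    ∫ x, F (fun j => x (σ j)) ∂(Measure.pi fun _ => μ) = ∫ x, F x ∂(Measure.pi fun _ => μ) :=
  (measurePreserving_arrowCongr' (fun _ => μ) (fun _ => μ) σ.symm (MeasurableEquiv.refl α)
    fun _ => MeasurePreserving.id μ).integral_comp' F

theorem integral_pi_castSucc_mul {α : Type*} [MeasurableSpace α] (μ : Measure α) [SigmaFinite μ]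
    {n : ℕ} (F : (Fin n → α) → ℝ) (G : α → ℝ) :
    ∫ x : Fin (n + 1) → α, F (fun j => x j.castSucc) * G (x (Fin.last n)) ∂(Measure.pi fun _ => μ) =
      (∫ x, F x ∂(Measure.pi fun _ => μ)) * ∫ x, G x ∂μ := by
  have hmp := measurePreserving_piFinSuccAbove (fun _ : Fin (n + 1) => μ) (Fin.last n)
  rw [mul_comm, ← integral_prod_mul, ← hmp.integral_comp']
  simp [mul_comm, Fin.init_def]

theorem integral_pi_succAbove_castSucc_mul {α : Type*} [MeasurableSpace α] (μ : Measure α)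
    [SigmaFinite μ] {n : ℕ} (k : Fin (n + 1)) (F : (Fin n → α) → ℝ) (G : α → α → ℝ) :
    ∫ x : Fin (n + 2) → α, F (fun j => x (k.succAbove j).castSucc) *
        G (x k.castSucc) (x (Fin.last (n + 1))) ∂(Measure.pi fun _ => μ) =
      (∫ x, F x ∂(Measure.pi fun _ => μ)) * ∫ p, G p.1 p.2 ∂(μ.prod μ) := by
  set π : Measure (Fin n → α) := Measure.pi fun _ => μ
  have hlast := measurePreserving_piFinSuccAbove (fun _ : Fin (n + 2) => μ) (Fin.last (n + 1))
  have hk := measurePreserving_piFinSuccAbove (fun _ : Fin (n + 1) => μ) k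
  calc _ = ∫ p, F (fun j => p.2 (k.succAbove j)) * G (p.2 k) p.1
        ∂(μ.prod (Measure.pi fun _ : Fin (n + 1) => μ)) := by
        rw [← hlast.integral_comp']
        simp [Fin.init_def]
    _ = ∫ p, F p.2.2 * G p.2.1 p.1 ∂(μ.prod (μ.prod π)) := by
        rw [← ((MeasurePreserving.id μ).prod hk).integral_comp
          (MeasurableEmbedding.id.prodMap (MeasurableEquiv.measurableEmbedding _))]
        rfl
    _ = ∫ p, G p.1.2 p.1.1 * F p.2 ∂((μ.prod μ).prod π) := by
        rw [← (measurePreserving_prodAssoc μ μ π).integral_comp']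
        simp only [mul_comm]
        rfl
    _ = _ := by
        rw [integral_prod_mul (fun p : α × α => G p.2 p.1) F, mul_comm,
          ← integral_prod_swap (fun p : α × α => G p.2 p.1)]
        rfl

theorem ae_pi_pos {μ : Measure ℝ} [SigmaFinite μ] (hμ : ∀ᵐ x ∂μ, 0 < x) (N : ℕ) :
    ∀ᵐ x ∂(Measure.pi fun _ : Fin N => μ), ∀ i, 0 < x i :=
  ae_all_iff.2 fun _ => Measure.tendsto_eval_ae_ae.eventually hμ

theorem ae_pi_ne {α : Type*} [MeasurableSpace α] [MeasurableEq α] {μ : Measure α}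
    [SigmaFinite μ] [NullSingletonClass μ] {N : ℕ} {i j : Fin N}
    (hij : i ≠ j) : ∀ᵐ x ∂(Measure.pi fun _ : Fin N => μ), x i ≠ x j := by
  cases N with
  | zero => exact i.elim0
  | succ n =>
    obtain ⟨l, rfl⟩ := Fin.exists_succAbove_eq hij.symm
    have hmp := measurePreserving_piFinSuccAbove (fun _ : Fin (n + 1) => μ) i
    have hprod : ∀ᵐ p ∂(μ.prod (Measure.pi fun _ : Fin n => μ)), p.1 ≠ p.2 l := by
      have hmeas : MeasurableSet {p : α × (Fin n → α) | p.1 ≠ p.2 l} :=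
        (measurableSet_eq_fun (by fun_prop) (by fun_prop)).compl
      refine (Measure.ae_prod_iff_ae_ae hmeas).2 (Filter.Eventually.of_forall fun x => ?_)
      rw [ae_iff]
      simpa [eq_comm] using Measure.pi_hyperplane (fun _ : Fin n => μ) l x
    exact hmp.quasiMeasurePreserving.ae hprod

theorem ae_pi_injective {α : Type*} [MeasurableSpace α] [MeasurableEq α] (μ : Measure α)
    [SigmaFinite μ] [NullSingletonClass μ] (N : ℕ) :
    ∀ᵐ x ∂(Measure.pi fun _ : Fin N => μ), Function.Injective x := by
  have hne : ∀ᵐ x ∂(Measure.pi fun _ : Fin N => μ), ∀ i j, i ≠ j → x i ≠ x j :=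
    ae_all_iff.2 fun i => ae_all_iff.2 fun j => ae_all_iff.2 ae_pi_ne
  filter_upwards [hne] with x hx i j hij
  exact not_imp_not.1 (hx i j) hij

/-- The integral of Schur's product against `f₁ ⊗ ⋯ ⊗ f_N`. -/
def schurMoment (μ : Measure ℝ) {N : ℕ} (f : Fin N → ℝ → ℝ) : ℝ :=
  ∫ x, schurProd x * ∏ j, f j (x j) ∂(Measure.pi fun _ => μ)

/-- The integral of the skew kernel against `f ⊗ g`. -/
def skewMoment (μ : Measure ℝ) (f g : ℝ → ℝ) : ℝ :=
  ∫ p, skewKernel p.1 p.2 * (f p.1 * g p.2) ∂(μ.prod μ)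

variable {μ : Measure ℝ}

theorem integrable_skewKernel_mul (hμ : ∀ᵐ x ∂μ, 0 < x) {f g : ℝ → ℝ} (hf : Integrable f μ)
    (hg : Integrable g μ) :
    Integrable (fun p : ℝ × ℝ => skewKernel p.1 p.2 * (f p.1 * g p.2)) (μ.prod μ) := by
  refine (hf.mul_prod hg).bdd_mul (c := 1) measurable_skewKernel.aestronglyMeasurable ?_
  filter_upwards [Measure.quasiMeasurePreserving_fst.ae hμ,
    Measure.quasiMeasurePreserving_snd.ae hμ] with p hp₁ hp₂ using abs_skewKernel_le_one hp₁ hp₂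

theorem skewMoment_swap [SFinite μ] (f g : ℝ → ℝ) : skewMoment μ f g = -skewMoment μ g f := by
  rw [skewMoment, skewMoment, ← integral_prod_swap, ← integral_neg]
  congr! 2 with p
  rw [Prod.fst_swap, Prod.snd_swap, skewKernel_swap]
  ring

variable [SigmaFinite μ]

theorem integrable_pi_mul_prod (hμ : ∀ᵐ x ∂μ, 0 < x) {N : ℕ} {f : Fin N → ℝ → ℝ}
    (hf : ∀ j, Integrable (f j) μ) {F : (Fin N → ℝ) → ℝ} (hF : Measurable F)
    (hF_le : ∀ x, (∀ i, 0 < x i) → |F x| ≤ 1) :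
    Integrable (fun x => F x * ∏ j, f j (x j)) (Measure.pi fun _ => μ) := by
  refine (Integrable.fintype_prod hf).bdd_mul (c := 1) hF.aestronglyMeasurable ?_
  filter_upwards [ae_pi_pos hμ N] with x hx using hF_le x hx

theorem schurMoment_comp_perm {N : ℕ} (f : Fin N → ℝ → ℝ) (σ : Equiv.Perm (Fin N)) :
    schurMoment μ (fun j => f (σ j)) = (Equiv.Perm.sign σ : ℤ) * schurMoment μ f := by
  unfold schurMoment
  rw [← integral_pi_comp_perm μ σ, ← integral_const_mul]
  congr with x
  rw [schurProd_comp_perm, mul_assoc, ← Equiv.prod_comp σ (fun j => f j (x j))]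

theorem schurMoment_eq_zero {N : ℕ} {f : Fin N → ℝ → ℝ} {i j : Fin N} (hij : i ≠ j)
    (hf : f i = f j) : schurMoment μ f = 0 := by
  have hswap := schurMoment_comp_perm (μ := μ) f (Equiv.swap i j)
  have hcomp : (fun l => f (Equiv.swap i j l)) = f := by
    ext1 l
    rw [Equiv.swap_apply_def]
    split_ifs with hi hj
    · rw [hi, hf]
    · rw [hj, hf]
    · rfl
  rw [hcomp, Equiv.Perm.sign_swap hij] at hswap
  push_cast at hswap
  linarith

theorem schurProd_mul_det {N : ℕ} (f : Fin N → ℝ → ℝ) (x : Fin N → ℝ) :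
    schurProd x * (Matrix.of fun i j => f i (x j)).det =
      ∑ σ : Equiv.Perm (Fin N), (Equiv.Perm.sign σ : ℤ) *
        (schurProd x * ∏ j, f (σ j) (x j)) := by
  rw [Matrix.det_apply', Finset.mul_sum]
  exact Finset.sum_congr rfl fun σ _ => by simp only [Matrix.of_apply]; ring

theorem integrable_schurProd_mul_det (hμ : ∀ᵐ x ∂μ, 0 < x) {N : ℕ} {f : Fin N → ℝ → ℝ}
    (hf : ∀ j, Integrable (f j) μ) :
    Integrable (fun x => schurProd x * (Matrix.of fun i j => f i (x j)).det)
      (Measure.pi fun _ => μ) := by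
  simp only [schurProd_mul_det]
  exact integrable_finsetSum _ fun σ _ => (integrable_pi_mul_prod hμ (fun j => hf (σ j))
    measurable_schurProd fun _ => abs_schurProd_le_one).const_mul _

theorem integral_schurProd_mul_det (hμ : ∀ᵐ x ∂μ, 0 < x) {N : ℕ} {f : Fin N → ℝ → ℝ}
    (hf : ∀ j, Integrable (f j) μ) :
    ∫ x, schurProd x * (Matrix.of fun i j => f i (x j)).det ∂(Measure.pi fun _ => μ) =
      N.factorial * schurMoment μ f := by
  have hterm : ∀ σ : Equiv.Perm (Fin N), ∫ x, (Equiv.Perm.sign σ : ℤ) *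
      (schurProd x * ∏ j, f (σ j) (x j)) ∂(Measure.pi fun _ => μ) = schurMoment μ f := fun σ => by
    rw [integral_const_mul]
    change _ * schurMoment μ (fun j => f (σ j)) = _
    rw [schurMoment_comp_perm, ← mul_assoc, ← Int.cast_mul, Int.units_coe_mul_self, Int.cast_one,
      one_mul]
  simp only [schurProd_mul_det]
  rw [integral_finsetSum _ fun σ _ => (integrable_pi_mul_prod hμ (fun j => hf (σ j))
    measurable_schurProd fun _ => abs_schurProd_le_one).const_mul _]
  simp only [hterm, Finset.sum_const, Finset.card_univ, Fintype.card_perm, Fintype.card_fin,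
    nsmul_eq_mul]

theorem integrable_schurProd_mul_skewKernel_mul (hμ : ∀ᵐ x ∂μ, 0 < x) {n : ℕ}
    {f : Fin (n + 2) → ℝ → ℝ} (hf : ∀ j, Integrable (f j) μ) (k : Fin (n + 1)) :
    Integrable (fun x : Fin (n + 2) → ℝ => schurProd (fun j => x (k.succAbove j).castSucc) *
      skewKernel (x k.castSucc) (x (Fin.last (n + 1))) * ∏ j, f j (x j))
      (Measure.pi fun _ => μ) := by
  refine integrable_pi_mul_prod hμ hf ?_ fun x hx => ?_
  · exact (measurable_schurProd.comp (by fun_prop)).mul (measurable_skewKernel.comp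
      (f := fun x : Fin (n + 2) → ℝ => (x k.castSucc, x (Fin.last (n + 1)))) (by fun_prop))
  · rw [abs_mul]
    exact mul_le_one₀ (abs_schurProd_le_one fun j => hx _) (abs_nonneg _)
      (abs_skewKernel_le_one (hx _) (hx _))

theorem integral_schurProd_mul_skewKernel_mul {n : ℕ} (f : Fin (n + 2) → ℝ → ℝ)
    (k : Fin (n + 1)) :
    ∫ x : Fin (n + 2) → ℝ, schurProd (fun j => x (k.succAbove j).castSucc) *
      skewKernel (x k.castSucc) (x (Fin.last (n + 1))) * ∏ j, f j (x j) ∂(Measure.pi fun _ => μ) =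
      schurMoment μ (fun j => f (k.succAbove j).castSucc) *
        skewMoment μ (f k.castSucc) (f (Fin.last (n + 1))) := by
  refine Eq.trans ?_ (integral_pi_succAbove_castSucc_mul μ k
    (fun x => schurProd x * ∏ j, f (k.succAbove j).castSucc (x j))
    fun x y => skewKernel x y * (f k.castSucc x * f (Fin.last (n + 1)) y))
  congr with x
  rw [Fin.prod_univ_castSucc, Fin.prod_univ_succAbove _ k]
  ring

theorem integral_schurProd_castSucc_mul {n : ℕ} (f : Fin (n + 1) → ℝ → ℝ) :
    ∫ x : Fin (n + 1) → ℝ, schurProd (fun j => x (Fin.castSucc j)) * ∏ j, f j (x j)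
      ∂(Measure.pi fun _ => μ) =
      schurMoment μ (fun j => f (Fin.castSucc j)) * ∫ x, f (Fin.last n) x ∂μ := by
  rw [schurMoment, ← integral_pi_castSucc_mul]
  simp only [Fin.prod_univ_castSucc, mul_assoc]

theorem sum_schurMoment_succAbove_mul_skewMoment [NullSingletonClass μ] (hμ : ∀ᵐ x ∂μ, 0 < x)
    {n : ℕ} {f : Fin (n + 2) → ℝ → ℝ} (hf : ∀ j, Integrable (f j) μ) :
    ∑ k : Fin (n + 1), (-1) ^ (n + k : ℕ) * schurMoment μ (fun j => f (k.succAbove j).castSucc) *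
        skewMoment μ (f k.castSucc) (f (Fin.last (n + 1))) =
      schurMoment μ f - if Even n then 0 else
        schurMoment μ (fun j => f (Fin.castSucc j)) * ∫ x, f (Fin.last (n + 1)) x ∂μ := by
  have hS : Integrable (fun x => schurProd x * ∏ j, f j (x j)) (Measure.pi fun _ => μ) :=
    integrable_pi_mul_prod hμ hf measurable_schurProd fun _ => abs_schurProd_le_one
  have hS' : Integrable (fun x => schurProd (fun j => x (Fin.castSucc j)) * ∏ j, f j (x j))
      (Measure.pi fun _ => μ) :=
    integrable_pi_mul_prod hμ hf (by fun_prop) fun x hx => abs_schurProd_le_one fun j => hx _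
  have hpointwise : ∀ᵐ x ∂(Measure.pi fun _ : Fin (n + 2) => μ),
      ∑ k : Fin (n + 1), (-1) ^ (n + k : ℕ) * (schurProd (fun j => x (k.succAbove j).castSucc) *
        skewKernel (x k.castSucc) (x (Fin.last (n + 1))) * ∏ j, f j (x j)) =
      schurProd x * ∏ j, f j (x j) - (if Even n then 0 else 1) *
        (schurProd (fun j => x (Fin.castSucc j)) * ∏ j, f j (x j)) := by
    filter_upwards [ae_pi_pos hμ (n + 2), ae_pi_injective μ (n + 2)] with x hx hinj
    have h := sum_schurProd_succAbove_mul_skewKernel hinj fun i j => (add_pos (hx i) (hx j)).ne'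
    simp only [← mul_assoc, ← Finset.sum_mul, h]
    split_ifs <;> ring
  have hint := integral_congr_ae hpointwise
  rw [integral_finsetSum _ fun k _ => (integrable_schurProd_mul_skewKernel_mul hμ hf k).const_mul _,
    integral_sub hS (hS'.const_mul _)] at hint
  simp only [integral_const_mul, integral_schurProd_mul_skewKernel_mul,
    integral_schurProd_castSucc_mul] at hint
  refine (Finset.sum_congr rfl fun k _ => mul_assoc _ _ _).trans (hint.trans ?_)
  split_ifs <;> simp only [schurMoment, zero_mul, one_mul]

end SchurMoment

section Determinants

variable {ι : Type*} [Fintype ι] [DecidableEq ι]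

theorem det_mul_det_eq_sum_prod {R : Type*} [CommRing R] (A B : Matrix ι ι R) :
    A.det * B.det = ∑ σ : Equiv.Perm ι, ∑ τ : Equiv.Perm ι,
      ((Equiv.Perm.sign σ : ℤ) * (Equiv.Perm.sign τ : ℤ) : R) *
        ∏ j, A (σ j) j * B (τ j) j := by
  rw [Matrix.det_apply', Matrix.det_apply', Finset.sum_mul_sum]
  simp only [Finset.prod_mul_distrib]
  exact Finset.sum_congr rfl fun σ _ => Finset.sum_congr rfl fun τ _ => mul_mul_mul_comm _ _ _ _

theorem sum_sum_sign_mul_sign_mul_prod {R : Type*} [CommRing R] (A : Matrix ι ι R) :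
    ∑ σ : Equiv.Perm ι, ∑ τ : Equiv.Perm ι,
      ((Equiv.Perm.sign σ : ℤ) * (Equiv.Perm.sign τ : ℤ) : R) * ∏ j, A (σ j) (τ j) =
      (Fintype.card ι).factorial * A.det := by
  have hcol : ∀ τ : Equiv.Perm ι, ∑ σ : Equiv.Perm ι,
      ((Equiv.Perm.sign σ : ℤ) * (Equiv.Perm.sign τ : ℤ) : R) * ∏ j, A (σ j) (τ j) = A.det :=
    fun τ => by
      have hdet := Matrix.det_permute' τ A
      rw [Matrix.det_apply'] at hdet
      simp only [Matrix.submatrix_apply, id] at hdet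
      simp only [mul_right_comm, ← Finset.sum_mul, hdet]
      rw [mul_right_comm, ← Int.cast_mul, Int.units_coe_mul_self, Int.cast_one, one_mul]
  rw [Finset.sum_comm, Finset.sum_congr rfl fun τ _ => hcol τ, Finset.sum_const, Finset.card_univ,
    Fintype.card_perm, nsmul_eq_mul]

section Kernel

variable {α β R : Type*} [CommRing R] {H : α → β → R} {f : ι → α → R}
  {g : ι → β → R}

theorem det_mul_det_mul_det_eq_sum_perm (x : ι → α) (y : ι → β) :
    (Matrix.of fun j k => H (x j) (y k)).det * (Matrix.of fun i j => f i (x j)).det *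
        (Matrix.of fun i j => g i (y j)).det =
      ∑ σ : Equiv.Perm ι, (∏ j, H (x (σ j)) (y j)) *
        (Matrix.of fun i j => f i (x (σ j))).det * (Matrix.of fun i j => g i (y j)).det := by
  rw [Matrix.det_apply', Finset.sum_mul, Finset.sum_mul]
  refine Finset.sum_congr rfl fun σ _ => ?_
  have hperm : (Matrix.of fun i j => f i (x (σ j))).det =
      (Equiv.Perm.sign σ : ℤ) * (Matrix.of fun i j => f i (x j)).det :=
    Matrix.det_permute' σ (Matrix.of fun i j => f i (x j))
  rw [hperm]
  simp only [Matrix.of_apply]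
  ring

theorem prod_mul_det_mul_det (w : ι → α × β) :
    (∏ j, H (w j).1 (w j).2) * (Matrix.of fun i j => f i (w j).1).det *
        (Matrix.of fun i j => g i (w j).2).det =
      (Matrix.of fun i j => H (w j).1 (w j).2 * f i (w j).1).det *
        (Matrix.of fun i j => g i (w j).2).det :=
  congrArg (· * _) (Matrix.det_mul_row (fun j => H (w j).1 (w j).2) (Matrix.of _)).symm

end Kernel

section Andreief

variable {α β : Type*} [MeasurableSpace α] [MeasurableSpace β] {μ : Measure α} {ν : Measure β}
  [SigmaFinite μ] [SigmaFinite ν]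

theorem integrable_det_mul_det {F G : ι → α → ℝ}
    (hFG : ∀ i j, Integrable (fun z => F i z * G j z) μ) :
    Integrable (fun x : ι → α => (Matrix.of fun i j => F i (x j)).det *
      (Matrix.of fun i j => G i (x j)).det) (Measure.pi fun _ => μ) := by
  simp only [det_mul_det_eq_sum_prod]
  exact integrable_finsetSum _ fun σ _ => integrable_finsetSum _ fun τ _ =>
    (Integrable.fintype_prod fun j => hFG (σ j) (τ j)).const_mul _

theorem integral_det_mul_det {F G : ι → α → ℝ}
    (hFG : ∀ i j, Integrable (fun z => F i z * G j z) μ) :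
    ∫ x : ι → α, (Matrix.of fun i j => F i (x j)).det * (Matrix.of fun i j => G i (x j)).det
        ∂(Measure.pi fun _ => μ) =
      (Fintype.card ι).factorial * (Matrix.of fun i j => ∫ z, F i z * G j z ∂μ).det := by
  have hint : ∀ σ τ : Equiv.Perm ι, Integrable (fun x : ι → α =>
      ((Equiv.Perm.sign σ : ℤ) * (Equiv.Perm.sign τ : ℤ) : ℝ) *
        ∏ j, F (σ j) (x j) * G (τ j) (x j)) (Measure.pi fun _ => μ) := fun σ τ =>
    (Integrable.fintype_prod fun j => hFG (σ j) (τ j)).const_mul _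
  simp only [det_mul_det_eq_sum_prod, Matrix.of_apply]
  rw [← sum_sum_sign_mul_sign_mul_prod,
    integral_finsetSum _ fun σ _ => integrable_finsetSum _ fun τ _ => hint σ τ]
  refine Finset.sum_congr rfl fun σ _ => ?_
  rw [integral_finsetSum _ fun τ _ => hint σ τ]
  refine Finset.sum_congr rfl fun τ _ => ?_
  rw [integral_const_mul]
  exact congrArg _ (integral_fintype_prod_eq_prod fun j z => F (σ j) z * G (τ j) z)

variable {H : α → β → ℝ} {f : ι → α → ℝ} {g : ι → β → ℝ}

theorem integrable_prod_mul_det_mul_det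
    (hH : ∀ i j, Integrable (fun z : α × β => H z.1 z.2 * f i z.1 * g j z.2) (μ.prod ν)) :
    Integrable (fun z : (ι → α) × (ι → β) => (∏ j, H (z.1 j) (z.2 j)) *
      (Matrix.of fun i j => f i (z.1 j)).det * (Matrix.of fun i j => g i (z.2 j)).det)
      ((Measure.pi fun _ => μ).prod (Measure.pi fun _ => ν)) := by
  rw [← (measurePreserving_arrowProdEquivProdArrow α β ι (fun _ => μ)
    (fun _ => ν)).integrable_comp_emb (MeasurableEquiv.measurableEmbedding _)]
  exact (integrable_det_mul_det hH).congr
    (Filter.Eventually.of_forall fun w => (prod_mul_det_mul_det w).symm)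

theorem integral_prod_mul_det_mul_det
    (hH : ∀ i j, Integrable (fun z : α × β => H z.1 z.2 * f i z.1 * g j z.2) (μ.prod ν)) :
    ∫ z : (ι → α) × (ι → β), (∏ j, H (z.1 j) (z.2 j)) *
        (Matrix.of fun i j => f i (z.1 j)).det * (Matrix.of fun i j => g i (z.2 j)).det
        ∂((Measure.pi fun _ => μ).prod (Measure.pi fun _ => ν)) =
      (Fintype.card ι).factorial *
        (Matrix.of fun i j => ∫ z, H z.1 z.2 * f i z.1 * g j z.2 ∂(μ.prod ν)).det := by
  rw [← (measurePreserving_arrowProdEquivProdArrow α β ι (fun _ => μ)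
    (fun _ => ν)).integral_comp', ← integral_det_mul_det hH]
  exact integral_congr_ae (Filter.Eventually.of_forall prod_mul_det_mul_det)

theorem integral_det_mul_det_mul_det
    (hH : ∀ i j, Integrable (fun z : α × β => H z.1 z.2 * f i z.1 * g j z.2) (μ.prod ν)) :
    ∫ z : (ι → α) × (ι → β), (Matrix.of fun j k => H (z.1 j) (z.2 k)).det *
        (Matrix.of fun i j => f i (z.1 j)).det * (Matrix.of fun i j => g i (z.2 j)).det
        ∂((Measure.pi fun _ => μ).prod (Measure.pi fun _ => ν)) =
      ((Fintype.card ι).factorial : ℝ) ^ 2 *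
        (Matrix.of fun i j => ∫ z, H z.1 z.2 * f i z.1 * g j z.2 ∂(μ.prod ν)).det := by
  -- The terms of `det (H (x_j) (y_k))` contribute equally, after relabelling the `x_j`.
  set π := (Measure.pi fun _ : ι => μ).prod (Measure.pi fun _ : ι => ν)
  set Φ : (ι → α) × (ι → β) → ℝ := fun z => (∏ j, H (z.1 j) (z.2 j)) *
    (Matrix.of fun i j => f i (z.1 j)).det * (Matrix.of fun i j => g i (z.2 j)).det
  set relabel := fun σ : Equiv.Perm ι =>
    (MeasurableEquiv.arrowCongr' σ.symm (MeasurableEquiv.refl α)).prodCongr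
      (MeasurableEquiv.refl (ι → β))
  have hrelabel : ∀ σ, MeasurePreserving (relabel σ) π π := fun σ =>
    (measurePreserving_arrowCongr' (fun _ => μ) (fun _ => μ) σ.symm (MeasurableEquiv.refl α)
      fun _ => MeasurePreserving.id μ).prod (MeasurePreserving.id _)
  have hΦ : ∀ σ, Integrable (fun z => Φ (relabel σ z)) π := fun σ =>
    ((hrelabel σ).integrable_comp_emb (relabel σ).measurableEmbedding).2
      (integrable_prod_mul_det_mul_det hH)
  calc _ = ∫ z, ∑ σ, Φ (relabel σ z) ∂π := integral_congr_ae <|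
        Filter.Eventually.of_forall fun z => det_mul_det_mul_det_eq_sum_perm z.1 z.2
    _ = ∑ _ : Equiv.Perm ι, ∫ z, Φ z ∂π := by
        rw [integral_finsetSum _ fun σ _ => hΦ σ]
        exact Finset.sum_congr rfl fun σ _ => (hrelabel σ).integral_comp' Φ
    _ = _ := by
        rw [integral_prod_mul_det_mul_det hH, Finset.sum_const, Finset.card_univ,
          Fintype.card_perm, nsmul_eq_mul, ← mul_assoc, sq]

end Andreief

theorem det_eq_det_submatrix_castSucc_mul {R : Type*} [CommRing R] {n : ℕ}
    {A : Matrix (Fin (n + 1)) (Fin (n + 1)) R} {c : Fin (n + 1) → R} (hc : c (Fin.last n) = 1)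
    (hA : ∀ k : Fin n, (c ᵥ* A) k.castSucc = 0) :
    A.det = (A.submatrix Fin.castSucc Fin.castSucc).det * (c ᵥ* A) (Fin.last n) := by
  have hrow : (A.updateRow (Fin.last n) (c ᵥ* A)).det = A.det := by
    have h := Matrix.det_updateRow_sum A (Fin.last n) c
    rw [hc, one_smul] at h
    rw [← h]
    congr 2
    ext k
    simp [Matrix.vecMul, dotProduct]
  rw [← hrow, Matrix.det_succ_row _ (Fin.last n), Fin.sum_univ_castSucc]
  simp only [Matrix.updateRow_self, hA, mul_zero, zero_mul, Finset.sum_const_zero, zero_add,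
    Fin.val_last, Even.neg_one_pow ⟨n, rfl⟩, one_mul]
  rw [mul_comm, Matrix.submatrix_updateRow_succAbove]
  simp only [Fin.succAbove_last]

theorem prod_nodalWeight_neg_mul_det_vandermonde {K : Type*} [Field K] {N : ℕ} {y : Fin N → K}
    (hy : Function.Injective y) :
    (∏ k, Lagrange.nodalWeight Finset.univ (-y) k) * (Matrix.vandermonde (-y)).det *
      (Matrix.vandermonde y).det = 1 := by
  have hne : ∏ k, ∏ j ∈ {k}ᶜ, (y j - y k) ≠ 0 :=
    Finset.prod_ne_zero_iff.2 fun k _ => Finset.prod_ne_zero_iff.2 fun j hj =>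
      sub_ne_zero.2 (hy.ne (by simpa using hj))
  have hweight : ∏ k, Lagrange.nodalWeight Finset.univ (-y) k =
      (∏ k, ∏ j ∈ {k}ᶜ, (y j - y k))⁻¹ := by
    simp only [Lagrange.nodalWeight, Pi.neg_apply, neg_sub_neg, Finset.prod_inv_distrib,
      Finset.compl_singleton]
  rw [hweight, mul_assoc, inv_mul_eq_one₀ hne,
    ← Finset.prod_prod_Ioi_mul_eq_prod_prod_off_diag fun k j => y k - y j,
    Matrix.det_vandermonde, Matrix.det_vandermonde]
  simp only [Pi.neg_apply, neg_sub_neg, Finset.prod_mul_distrib, mul_comm]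

theorem det_vandermonde_eq_det_cauchy_mul {K : Type*} [Field K] {N : ℕ} {x y : Fin N → K}
    (hy : Function.Injective y) (hxy : ∀ j k, x j + y k ≠ 0) :
    (Matrix.vandermonde x).det = (∏ j, ∏ k, (x j + y k)) *
      (∏ k, Lagrange.nodalWeight Finset.univ (-y) k) *
      (Matrix.of fun j k => (x j + y k)⁻¹).det * (Matrix.vandermonde (-y)).det := by
  -- The matrix of `x_j ^ i` is the matrix of the values at the `x_j` of the Lagrange basis of the
  -- nodes `-y_k`, times the matrix of `(-y_k) ^ i`.
  have hbasis : ∀ j k, (Lagrange.basis Finset.univ (-y) k).eval (x j) =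
      (∏ l, (x j + y l)) * (Lagrange.nodalWeight Finset.univ (-y) k * (x j + y k)⁻¹) := by
    intro j k
    rw [Lagrange.eval_basis_not_at_node (Finset.mem_univ k)
      fun h => hxy j k (by rw [h, Pi.neg_apply, neg_add_cancel]), Lagrange.eval_nodal]
    simp only [Pi.neg_apply, sub_neg_eq_add]
  have hinterp : Matrix.vandermonde x =
      (Matrix.of fun j k => (Lagrange.basis Finset.univ (-y) k).eval (x j)) *
        Matrix.vandermonde (-y) := by
    ext j i
    have hdeg : (X ^ (i : ℕ) : K[X]).degree < (Finset.univ : Finset (Fin N)).card := by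
      rw [degree_X_pow, Finset.card_univ, Fintype.card_fin]
      exact_mod_cast i.isLt
    have hinj : Set.InjOn (-y) ↑(Finset.univ : Finset (Fin N)) :=
      fun i _ j _ hij => hy (neg_injective hij)
    have h := congrArg (eval (x j)) (Lagrange.eq_interpolate hinj hdeg)
    simpa [Lagrange.interpolate_apply, eval_finsetSum, Matrix.mul_apply, mul_comm] using h
  rw [hinterp, Matrix.det_mul]
  simp only [hbasis]
  have hcol := Matrix.det_mul_column (fun j => ∏ l, (x j + y l))
    (Matrix.of fun j k => Lagrange.nodalWeight Finset.univ (-y) k * (x j + y k)⁻¹)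
  have hrow := Matrix.det_mul_row (Lagrange.nodalWeight Finset.univ (-y))
    (Matrix.of fun j k => (x j + y k)⁻¹)
  simp only [Matrix.of_apply] at hcol hrow
  rw [hcol, hrow]
  ring

theorem det_cauchy {K : Type*} [Field K] {N : ℕ} {x y : Fin N → K} (hxy : ∀ j k, x j + y k ≠ 0) :
    (Matrix.of fun j k => (x j + y k)⁻¹).det =
      (Matrix.vandermonde x).det * (Matrix.vandermonde y).det / ∏ j, ∏ k, (x j + y k) := by
  by_cases hy : Function.Injective y
  · have hprod : ∏ j, ∏ k, (x j + y k) ≠ 0 :=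
      Finset.prod_ne_zero_iff.2 fun j _ => Finset.prod_ne_zero_iff.2 fun k _ => hxy j k
    rw [eq_div_iff hprod, det_vandermonde_eq_det_cauchy_mul hy hxy]
    linear_combination (-(Matrix.of fun j k => (x j + y k)⁻¹).det * ∏ j, ∏ k, (x j + y k)) *
      prod_nodalWeight_neg_mul_det_vandermonde hy
  · obtain ⟨j, k, hjk, hne⟩ : ∃ j k, y j = y k ∧ j ≠ k := by
      simpa [Function.Injective] using hy
    rw [Matrix.det_zero_of_column_eq hne (by simp [hjk]),
      Matrix.det_vandermonde_eq_zero_iff.2 ⟨j, k, hjk, hne⟩, mul_zero, zero_div]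

end Determinants

section BilinearForms

variable {R : Type*} [CommRing R] {n : ℕ} {p : R[X]}

theorem linearMap_apply_eq_sum_coeff (L : R[X] →ₗ[R] R) (hp : p.natDegree ≤ n) :
    L p = ∑ j : Fin (n + 1), p.coeff j * L (X ^ (j : ℕ)) := by
  conv_lhs => rw [p.as_sum_range_C_mul_X_pow' (Nat.lt_succ_of_le hp)]
  rw [map_sum, Fin.sum_univ_eq_sum_range (fun j => p.coeff j * L (X ^ j))]
  exact Finset.sum_congr rfl fun j _ => by rw [← smul_eq_C_mul, map_smul, smul_eq_mul]

theorem linearMap_apply_congr {L L' : R[X] →ₗ[R] R} (hL : ∀ i ≤ n, L (X ^ i) = L' (X ^ i))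
    (hp : p.natDegree ≤ n) : L p = L' p := by
  rw [linearMap_apply_eq_sum_coeff L hp, linearMap_apply_eq_sum_coeff L' hp]
  exact Finset.sum_congr rfl fun j _ => by rw [hL j j.is_le]

/-- The Gram matrix of the monomials of degree less than `n`. -/
def monomialGram (M : LinearMap.BilinForm R R[X]) (n : ℕ) : Matrix (Fin n) (Fin n) R :=
  Matrix.of fun j k => M (X ^ (j : ℕ)) (X ^ (k : ℕ))

variable {M : LinearMap.BilinForm R R[X]}

theorem det_monomialGram_flip (M : LinearMap.BilinForm R R[X]) (n : ℕ) :
    (monomialGram M.flip n).det = (monomialGram M n).det :=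
  Matrix.det_transpose (monomialGram M n)

theorem det_monomialGram_succ (hdeg : p.natDegree ≤ n) (hlead : p.coeff n = 1)
    (horth : ∀ k < n, M p (X ^ k) = 0) :
    (monomialGram M (n + 1)).det = (monomialGram M n).det * M p (X ^ n) := by
  have hvec : ∀ k, ((fun j : Fin (n + 1) => p.coeff j) ᵥ* monomialGram M (n + 1)) k =
      M p (X ^ (k : ℕ)) := fun k =>
    (linearMap_apply_eq_sum_coeff (M.flip (X ^ (k : ℕ))) hdeg).symm
  rw [det_eq_det_submatrix_castSucc_mul (c := fun j => p.coeff j) hlead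
    fun k => (hvec _).trans (horth k k.isLt), hvec]
  rfl

theorem det_bordered_monomialGram (hdeg : p.natDegree ≤ n) (hlead : p.coeff n = 1)
    (horth : ∀ k < n, M p (X ^ k) = 0) :
    (Matrix.of fun j k : Fin (n + 1) =>
      if (k : ℕ) < n then C (M (X ^ (j : ℕ)) (X ^ (k : ℕ))) else X ^ (j : ℕ)).det =
      C (monomialGram M n).det * p := by
  set A : Matrix (Fin (n + 1)) (Fin (n + 1)) R[X] := Matrix.of fun j k =>
    if (k : ℕ) < n then C (M (X ^ (j : ℕ)) (X ^ (k : ℕ))) else X ^ (j : ℕ)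
  set c : Fin (n + 1) → R[X] := fun j => C (p.coeff j)
  have hcol : ∀ k : Fin n, (c ᵥ* A) k.castSucc = 0 := fun k => by
    have h := linearMap_apply_eq_sum_coeff (M.flip (X ^ (k : ℕ))) hdeg
    simp only [LinearMap.BilinForm.flip_apply, horth k k.isLt] at h
    calc (c ᵥ* A) k.castSucc
        = C (∑ j : Fin (n + 1), p.coeff j * M (X ^ (j : ℕ)) (X ^ (k : ℕ))) := by
          simp [Matrix.vecMul, dotProduct, c, A]
      _ = 0 := by rw [← h, C_0]
  have hlast : (c ᵥ* A) (Fin.last n) = p := by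
    conv_rhs => rw [p.as_sum_range_C_mul_X_pow' (Nat.lt_succ_of_le hdeg)]
    simp [Matrix.vecMul, dotProduct, c, A, Finset.sum_range]
  rw [det_eq_det_submatrix_castSucc_mul (c := c) (by simp [c, hlead]) hcol, hlast, RingHom.map_det]
  congr 2
  ext1 j k
  simp [A, monomialGram]

end BilinearForms

section PartialSkewOrthogonality

variable {K : Type*} [Field K] {B : LinearMap.BilinForm K K[X]} {β : K[X] →ₗ[K] K} {τ : ℕ → K}
  {φ ψ : ℕ → K[X]} {n : ℕ} {q : K[X]}

/-- Monic polynomials `φ n` of degree `n` that are partial-skew-orthogonal for a form `B` and a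
functional `β`, with the normalisation prescribed by the sequence `τ`. -/
structure IsPartialSkewOrthogonal (B : LinearMap.BilinForm K K[X]) (β : K[X] →ₗ[K] K) (τ : ℕ → K)
    (φ : ℕ → K[X]) : Prop where
  monic : ∀ n, (φ n).Monic
  natDegree_eq : ∀ n, (φ n).natDegree = n
  even : ∀ n i, i ≤ 2 * n + 1 →
    B (φ (2 * n)) (X ^ i) = if i = 2 * n + 1 then τ (2 * n + 2) / τ (2 * n) else 0
  odd : ∀ n i, i ≤ 2 * n + 1 →
    B (φ (2 * n + 1)) (X ^ i) = -(τ (2 * n + 2) / τ (2 * n + 1)) * β (X ^ i)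

namespace IsPartialSkewOrthogonal

theorem coeff_self (hφ : IsPartialSkewOrthogonal B β τ φ) (n : ℕ) : (φ n).coeff n = 1 := by
  simpa only [hφ.natDegree_eq n] using (hφ.monic n).coeff_natDegree

theorem apply_of_even (hφ : IsPartialSkewOrthogonal B β τ φ) (hn : Even n)
    (hq : q.natDegree ≤ n + 1) : B (φ n) q = q.coeff (n + 1) * (τ (n + 2) / τ n) := by
  obtain ⟨m, rfl⟩ := even_iff_exists_two_mul.1 hn
  rw [mul_comm (q.coeff _)]
  refine linearMap_apply_congr (L' := (τ (2 * m + 2) / τ (2 * m)) • lcoeff K (2 * m + 1))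
    (fun i hi => ?_) hq
  simp [hφ.even m i hi, coeff_X_pow, eq_comm]

theorem apply_of_odd (hφ : IsPartialSkewOrthogonal B β τ φ) (hn : Odd n) (hq : q.natDegree ≤ n) :
    B (φ n) q = -(τ (n + 1) / τ n) * β q := by
  obtain ⟨m, rfl⟩ := hn
  exact linearMap_apply_congr (L' := -(τ (2 * m + 2) / τ (2 * m + 1)) • β) (hφ.odd m) hq

theorem functional_of_odd (hφ : IsPartialSkewOrthogonal B β τ φ) (hB : B.IsAlt)
    (hτ : ∀ n, τ n ≠ 0) (hn : Odd n) : β (φ n) = 0 := by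
  have h := hφ.apply_of_odd hn (hφ.natDegree_eq n).le
  rw [hB.self_eq_zero, eq_comm, mul_eq_zero] at h
  exact h.resolve_left (neg_ne_zero.2 (div_ne_zero (hτ _) (hτ _)))

theorem functional_of_even (hφ : IsPartialSkewOrthogonal B β τ φ) (hB : B.IsAlt)
    (hτ : ∀ n, τ n ≠ 0) (hn : Even n) : β (φ n) = τ (n + 1) / τ n := by
  have h₁ := hφ.apply_of_even hn (hφ.natDegree_eq (n + 1)).le
  have h₂ := hφ.apply_of_odd hn.add_one ((hφ.natDegree_eq n).trans_le n.le_succ)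
  rw [← hB.neg_eq, h₁, hφ.coeff_self] at h₂
  have := hτ n
  have := hτ (n + 1)
  have := hτ (n + 2)
  field_simp at h₂ ⊢
  linear_combination h₂

theorem functional_eq_zero_of_apply_eq_zero (hφ : IsPartialSkewOrthogonal B β τ φ)
    (hτ : ∀ n, τ n ≠ 0) (hn : Odd n) (hq : q.natDegree ≤ n) (h : B (φ n) q = 0) : β q = 0 := by
  rw [hφ.apply_of_odd hn hq] at h
  exact (mul_eq_zero.1 h).resolve_left (neg_ne_zero.2 (div_ne_zero (hτ _) (hτ _)))

theorem functional_eq_coeff_mul_of_apply_eq_zero (hφ : IsPartialSkewOrthogonal B β τ φ)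
    (hB : B.IsAlt) (hτ : ∀ n, τ n ≠ 0) (hn : Even n) (hq : q.natDegree ≤ n)
    (h : ∀ m < n, B (φ m) q = 0) : β q = q.coeff n * (τ (n + 1) / τ n) := by
  set r := q - C (q.coeff n) * φ n with hr
  have hr_deg : r.natDegree ≤ n := (natDegree_sub_le_of_le hq
    ((natDegree_C_mul_le _ _).trans (hφ.natDegree_eq n).le)).trans (max_self n).le
  have hr_coeff : r.coeff n = 0 := by simp [hr, hφ.coeff_self]
  have hβr : β r = 0 := by
    cases n with
    | zero => rw [eq_C_of_natDegree_le_zero hr_deg, hr_coeff, C_0, map_zero]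
    | succ m =>
      have horth : B (φ m) (φ (m + 1)) = 0 := by
        rw [← hB.neg_eq, hφ.apply_of_even hn ((hφ.natDegree_eq m).trans_le (by omega)),
          coeff_eq_zero_of_natDegree_lt ((hφ.natDegree_eq m).trans_lt (by omega)), zero_mul,
          neg_zero]
      refine hφ.functional_eq_zero_of_apply_eq_zero hτ (n := m)
        (Nat.not_even_iff_odd.1 (Nat.even_add_one.1 hn)) (natDegree_le_pred hr_deg hr_coeff) ?_
      rw [hr, map_sub, ← smul_eq_C_mul, map_smul, h m m.lt_succ_self, horth,
        smul_zero, sub_zero]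
  rw [hr, map_sub, ← smul_eq_C_mul, map_smul, hφ.functional_of_even hB hτ hn] at hβr
  exact sub_eq_zero.1 hβr

theorem eq_zero_of_apply_eq_zero (hφ : IsPartialSkewOrthogonal B β τ φ) (hB : B.IsAlt)
    (hτ : ∀ n, τ n ≠ 0) (hq : ∀ i ≤ q.natDegree + 1, B q (X ^ i) = 0) : q = 0 := by
  set k := q.natDegree with hk
  have horth : ∀ j ≤ k + 1, B (φ j) q = 0 := fun j hj => by
    rw [← hB.neg_eq, neg_eq_zero]
    exact linearMap_apply_congr (L' := 0) hq ((hφ.natDegree_eq j).trans_le hj)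
  have hratio : ∀ i j, τ i / τ j ≠ 0 := fun i j => div_ne_zero (hτ i) (hτ j)
  rw [← leadingCoeff_eq_zero, leadingCoeff, ← hk]
  rcases Nat.even_or_odd k with heven | hodd
  · have hβ : β q = 0 := hφ.functional_eq_zero_of_apply_eq_zero hτ heven.add_one
      (hk ▸ k.le_succ) (horth _ le_rfl)
    rw [hφ.functional_eq_coeff_mul_of_apply_eq_zero hB hτ heven hk.ge
      fun j hj => horth j (by omega)] at hβ
    exact (mul_eq_zero.1 hβ).resolve_right (hratio _ _)
  · obtain ⟨j, hj⟩ : ∃ j, k = j + 1 := ⟨k - 1, by have := hodd.pos; omega⟩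
    have h := hφ.apply_of_even (n := j) (by grind) (hk ▸ hj.le)
    rw [horth j (by omega), ← hj] at h
    exact (mul_eq_zero.1 h.symm).resolve_right (hratio _ _)

theorem unique (hφ : IsPartialSkewOrthogonal B β τ φ) (hψ : IsPartialSkewOrthogonal B β τ ψ)
    (hB : B.IsAlt) (hτ : ∀ n, τ n ≠ 0) : φ = ψ := by
  funext n
  rcases Nat.eq_zero_or_pos n with rfl | hn
  · rw [(hφ.monic 0).natDegree_eq_zero.1 (hφ.natDegree_eq 0),
      (hψ.monic 0).natDegree_eq_zero.1 (hψ.natDegree_eq 0)]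
  have happly : ∀ i ≤ n, B (φ n) (X ^ i) = B (ψ n) (X ^ i) := fun i hi => by
    rcases Nat.even_or_odd n with heven | hodd
    · have hi' := (natDegree_X_pow_le (R := K) i).trans (hi.trans n.le_succ)
      rw [hφ.apply_of_even heven hi', hψ.apply_of_even heven hi']
    · have hi' := (natDegree_X_pow_le (R := K) i).trans hi
      rw [hφ.apply_of_odd hodd hi', hψ.apply_of_odd hodd hi']
  have hdeg : (φ n - ψ n).natDegree ≤ n - 1 := natDegree_le_pred
    ((natDegree_sub_le_of_le (hφ.natDegree_eq n).le (hψ.natDegree_eq n).le).trans (max_self n).le)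
    (by rw [coeff_sub, hφ.coeff_self, hψ.coeff_self, sub_self])
  refine sub_eq_zero.1 (hφ.eq_zero_of_apply_eq_zero hB hτ fun i hi => ?_)
  rw [map_sub, LinearMap.sub_apply, happly i (by omega), sub_self]

end IsPartialSkewOrthogonal

/-- The form `(β ⊗ β + B) / 2`. When `B` and `β` are the moments of the kernels `(y - x) / (y + x)`
and `1` this is the moment form of the Cauchy kernel `y / (x + y)`. -/
def cauchyForm (β : K[X] →ₗ[K] K) (B : LinearMap.BilinForm K K[X]) : LinearMap.BilinForm K K[X] :=
  (2⁻¹ : K) • (LinearMap.BilinForm.linMulLin β β + B)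

theorem cauchyForm_apply (p q : K[X]) : cauchyForm β B p q = 2⁻¹ * (β p * β q + B p q) := rfl

theorem flip_cauchyForm (hB : B.IsAlt) :
    (cauchyForm β B).flip = cauchyForm β ((-1 : K) • B) := by
  refine LinearMap.ext fun p => LinearMap.ext fun q => ?_
  rw [LinearMap.BilinForm.flip_apply, cauchyForm_apply, cauchyForm_apply, LinearMap.smul_apply,
    LinearMap.smul_apply, smul_eq_mul, neg_one_mul, hB.neg_eq, mul_comm (β q)]

/-- The monic bi-orthogonal polynomials of `cauchyForm β B`, in the first variable for `ε = 1` and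
in the second for `ε = -1`, in terms of the partial-skew-orthogonal polynomials `φ`. -/
def cauchyPolynomial (τ : ℕ → K) (φ : ℕ → K[X]) (ε : K) : ℕ → K[X]
  | 0 => φ 0
  | n + 1 => φ (n + 1) + C (ε * (τ (n + 2) * τ n / τ (n + 1) ^ 2)) * φ n

theorem map_cauchyPolynomial_succ {V : Type*} [AddCommGroup V] [Module K V] (L : K[X] →ₗ[K] V)
    (τ : ℕ → K) (φ : ℕ → K[X]) (ε : K) (n : ℕ) :
    L (cauchyPolynomial τ φ ε (n + 1)) =
      L (φ (n + 1)) + (ε * (τ (n + 2) * τ n / τ (n + 1) ^ 2)) • L (φ n) := by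
  rw [cauchyPolynomial, map_add, ← smul_eq_C_mul, map_smul]

theorem cauchyPolynomial_add_cauchyPolynomial_neg (τ : ℕ → K) (φ : ℕ → K[X]) (ε : K) (n : ℕ) :
    cauchyPolynomial τ φ ε n + cauchyPolynomial τ φ (-ε) n = 2 * φ n := by
  cases n with
  | zero => exact (two_mul _).symm
  | succ n =>
    simp only [cauchyPolynomial, neg_mul, C_neg]
    ring

namespace IsPartialSkewOrthogonal

variable {ε : K}

theorem natDegree_cauchyPolynomial_le (hφ : IsPartialSkewOrthogonal B β τ φ) (ε : K) (n : ℕ) :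
    (cauchyPolynomial τ φ ε n).natDegree ≤ n := by
  cases n with
  | zero => exact (hφ.natDegree_eq 0).le
  | succ n =>
    exact (natDegree_add_le_of_le (hφ.natDegree_eq _).le ((natDegree_C_mul_le _ _).trans
      ((hφ.natDegree_eq n).trans_le n.le_succ))).trans (max_self _).le

theorem coeff_cauchyPolynomial_self (hφ : IsPartialSkewOrthogonal B β τ φ) (ε : K) (n : ℕ) :
    (cauchyPolynomial τ φ ε n).coeff n = 1 := by
  cases n with
  | zero => exact hφ.coeff_self 0
  | succ n =>
    rw [cauchyPolynomial, coeff_add, coeff_C_mul, hφ.coeff_self,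
      coeff_eq_zero_of_natDegree_lt ((hφ.natDegree_eq n).trans_lt n.lt_succ_self), mul_zero,
      add_zero]

theorem functional_cauchyPolynomial (hφ : IsPartialSkewOrthogonal B β τ φ) (hB : B.IsAlt)
    (hτ : ∀ n, τ n ≠ 0) (ε : K) (n : ℕ) :
    β (cauchyPolynomial τ φ ε n) = (if Even n then 1 else ε) * (τ (n + 1) / τ n) := by
  cases n with
  | zero => simp [cauchyPolynomial, hφ.functional_of_even hB hτ Even.zero]
  | succ n =>
    rw [map_cauchyPolynomial_succ, smul_eq_mul]
    rcases Nat.even_or_odd n with hn | hn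
    · rw [hφ.functional_of_odd hB hτ hn.add_one, hφ.functional_of_even hB hτ hn,
        if_neg (Nat.not_even_iff_odd.2 hn.add_one)]
      have := hτ n
      field_simp
      ring
    · rw [hφ.functional_of_even hB hτ hn.add_one, hφ.functional_of_odd hB hτ hn,
        if_pos hn.add_one]
      ring

theorem cauchyForm_cauchyPolynomial_of_natDegree_lt (hφ : IsPartialSkewOrthogonal B β τ φ)
    (hB : B.IsAlt) (hτ : ∀ n, τ n ≠ 0) (hε : ε * ε = 1) (hq : q.natDegree < n) :
    cauchyForm β (ε • B) (cauchyPolynomial τ φ ε n) q = 0 := by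
  obtain ⟨n, rfl⟩ : ∃ m, n = m + 1 := ⟨n - 1, by omega⟩
  rw [cauchyForm_apply, hφ.functional_cauchyPolynomial hB hτ, LinearMap.smul_apply,
    LinearMap.smul_apply, map_cauchyPolynomial_succ, LinearMap.add_apply, LinearMap.smul_apply]
  have := hτ n
  have := hτ (n + 1)
  rcases Nat.even_or_odd n with hn | hn
  · rw [hφ.apply_of_odd hn.add_one hq.le, hφ.apply_of_even hn hq.le,
      coeff_eq_zero_of_natDegree_lt hq, if_neg (Nat.not_even_iff_odd.2 hn.add_one)]
    simp only [smul_eq_mul]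
    ring
  · rw [hφ.apply_of_even hn.add_one (by omega), hφ.apply_of_odd hn (by omega),
      coeff_eq_zero_of_natDegree_lt (by omega), if_pos hn.add_one]
    simp only [smul_eq_mul]
    field_simp
    linear_combination (-2⁻¹ * β q * τ (n + 2)) * hε

theorem cauchyForm_cauchyPolynomial_self (hφ : IsPartialSkewOrthogonal B β τ φ) (hB : B.IsAlt)
    (hτ : ∀ n, τ n ≠ 0) (hε : ε * ε = 1) (n : ℕ) :
    cauchyForm β (ε • B) (cauchyPolynomial τ φ ε n) (φ n) = 2⁻¹ * (τ (n + 1) / τ n) ^ 2 := by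
  rw [cauchyForm_apply, hφ.functional_cauchyPolynomial hB hτ, LinearMap.smul_apply,
    LinearMap.smul_apply]
  cases n with
  | zero =>
    simp [cauchyPolynomial, hB.self_eq_zero, hφ.functional_of_even hB hτ Even.zero, sq]
  | succ n =>
    rw [map_cauchyPolynomial_succ, LinearMap.add_apply, LinearMap.smul_apply, hB.self_eq_zero]
    have := hτ n
    rcases Nat.even_or_odd n with hn | hn
    · rw [hφ.functional_of_odd hB hτ hn.add_one,
        hφ.apply_of_even hn (hφ.natDegree_eq _).le, hφ.coeff_self]
      simp only [smul_eq_mul]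
      field_simp
      linear_combination 2⁻¹ * (τ (n + 2) / τ (n + 1)) ^ 2 * hε
    · rw [hφ.functional_of_even hB hτ hn.add_one, if_pos hn.add_one, ← hB.neg_eq,
        hφ.apply_of_even hn.add_one ((hφ.natDegree_eq n).trans_le (by omega)),
        coeff_eq_zero_of_natDegree_lt ((hφ.natDegree_eq n).trans_lt (by omega))]
      simp only [smul_eq_mul]
      ring

theorem cauchyForm_cauchyPolynomial_X_pow_self (hφ : IsPartialSkewOrthogonal B β τ φ)
    (hB : B.IsAlt) (hτ : ∀ n, τ n ≠ 0) (hε : ε * ε = 1) (n : ℕ) :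
    cauchyForm β (ε • B) (cauchyPolynomial τ φ ε n) (X ^ n) = 2⁻¹ * (τ (n + 1) / τ n) ^ 2 := by
  rw [← hφ.cauchyForm_cauchyPolynomial_self hB hτ hε, ← sub_eq_zero, ← map_sub]
  rcases Nat.eq_zero_or_pos n with rfl | hn
  · rw [(hφ.monic 0).natDegree_eq_zero.1 (hφ.natDegree_eq 0), pow_zero, sub_self, map_zero]
  · refine hφ.cauchyForm_cauchyPolynomial_of_natDegree_lt hB hτ hε ?_
    have h : (X ^ n - φ n).natDegree ≤ n - 1 := natDegree_le_pred
      ((natDegree_sub_le_of_le (natDegree_X_pow_le n) (hφ.natDegree_eq n).le).trans (max_self n).le)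
      (by rw [coeff_sub, hφ.coeff_self, coeff_X_pow_self, sub_self])
    omega

theorem det_monomialGram_cauchyForm (hφ : IsPartialSkewOrthogonal B β τ φ) (hB : B.IsAlt)
    (hτ : ∀ n, τ n ≠ 0) (hε : ε * ε = 1) (n : ℕ) :
    (monomialGram (cauchyForm β (ε • B)) n).det = (2⁻¹) ^ n * (τ n / τ 0) ^ 2 := by
  induction n with
  | zero => simp [hτ 0]
  | succ n ih =>
    rw [det_monomialGram_succ (hφ.natDegree_cauchyPolynomial_le ε n)
      (hφ.coeff_cauchyPolynomial_self ε n) fun k hk =>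
        hφ.cauchyForm_cauchyPolynomial_of_natDegree_lt hB hτ hε
          ((natDegree_X_pow_le k).trans_lt hk),
      ih, hφ.cauchyForm_cauchyPolynomial_X_pow_self hB hτ hε, mul_mul_mul_comm, ← pow_succ,
      ← mul_pow, mul_comm (τ n / τ 0), div_mul_div_cancel₀ (hτ n)]

theorem det_monomialGram_cauchyForm_ne_zero [NeZero (2 : K)]
    (hφ : IsPartialSkewOrthogonal B β τ φ) (hB : B.IsAlt) (hτ : ∀ n, τ n ≠ 0) (hε : ε * ε = 1)
    (n : ℕ) : (monomialGram (cauchyForm β (ε • B)) n).det ≠ 0 := by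
  rw [hφ.det_monomialGram_cauchyForm hB hτ hε]
  exact mul_ne_zero (pow_ne_zero _ (inv_ne_zero two_ne_zero))
    (pow_ne_zero _ (div_ne_zero (hτ _) (hτ _)))

theorem det_bordered_cauchyForm (hφ : IsPartialSkewOrthogonal B β τ φ) (hB : B.IsAlt)
    (hτ : ∀ n, τ n ≠ 0) (hε : ε * ε = 1) (n : ℕ) :
    (Matrix.of fun j k : Fin (n + 1) => if (k : ℕ) < n then
      C (cauchyForm β (ε • B) (X ^ (j : ℕ)) (X ^ (k : ℕ))) else X ^ (j : ℕ)).det =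
      C (monomialGram (cauchyForm β (ε • B)) n).det * cauchyPolynomial τ φ ε n :=
  det_bordered_monomialGram (hφ.natDegree_cauchyPolynomial_le ε n)
    (hφ.coeff_cauchyPolynomial_self ε n) fun _ hk =>
      hφ.cauchyForm_cauchyPolynomial_of_natDegree_lt hB hτ hε ((natDegree_X_pow_le _).trans_lt hk)

end IsPartialSkewOrthogonal

end PartialSkewOrthogonality

section Moments

/-- The linear functional on polynomials with moments `m`. -/
def momentFunctional {R : Type*} [CommRing R] (m : ℕ → R) : R[X] →ₗ[R] R :=
  (basisMonomials R).constr R m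

/-- The bilinear form on polynomials with bimoments `m`. -/
def momentForm {R : Type*} [CommRing R] (m : ℕ → ℕ → R) : LinearMap.BilinForm R R[X] :=
  (basisMonomials R).constr R fun j => momentFunctional (m j)

theorem basisMonomials_apply (R : Type*) [CommRing R] (j : ℕ) : basisMonomials R j = X ^ j :=
  (congrFun (coe_basisMonomials R) j).trans (monomial_one_right_eq_X_pow j)

theorem momentFunctional_X_pow {R : Type*} [CommRing R] (m : ℕ → R) (j : ℕ) :
    momentFunctional m (X ^ j) = m j := by
  rw [← basisMonomials_apply, momentFunctional, Module.Basis.constr_basis]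

theorem momentForm_X_pow {R : Type*} [CommRing R] (m : ℕ → ℕ → R) (j k : ℕ) :
    momentForm m (X ^ j) (X ^ k) = m j k := by
  rw [← basisMonomials_apply R j, momentForm, Module.Basis.constr_basis, momentFunctional_X_pow]

theorem isAlt_momentForm {R : Type*} [CommRing R] [NoZeroDivisors R] [CharZero R] {m : ℕ → ℕ → R}
    (hm : ∀ j k, m j k = -m k j) : (momentForm m).IsAlt := by
  have hflip : (momentForm m).flip = -momentForm m :=
    LinearMap.BilinForm.ext_basis (basisMonomials R) fun j k => by
      simp only [basisMonomials_apply, LinearMap.BilinForm.flip_apply, LinearMap.neg_apply,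
        momentForm_X_pow, hm k j]
  refine fun p => self_eq_neg.1 ?_
  calc momentForm m p p = (momentForm m).flip p p := (LinearMap.BilinForm.flip_apply _ p p).symm
    _ = -momentForm m p p := by rw [hflip, LinearMap.neg_apply, LinearMap.neg_apply]

end Moments

section SkewOrthogonalPolynomial

variable {μ : Measure ℝ} {g : ℕ → ℝ → ℝ}

/-- The partial-skew-orthogonal polynomial of degree `n`, whose coefficients are the `n`-fold
Schur moments of `g 0, …, g n` with one function left out. -/
def skewOrthogonalPolynomial (μ : Measure ℝ) (g : ℕ → ℝ → ℝ) (n : ℕ) : ℝ[X] :=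
  ∑ k : Fin (n + 1), C ((-1) ^ (n + k : ℕ) * schurMoment μ (fun j : Fin n => g (k.succAbove j)) /
    schurMoment μ fun j : Fin n => g j) * X ^ (k : ℕ)

theorem natDegree_skewOrthogonalPolynomial_le (μ : Measure ℝ) (g : ℕ → ℝ → ℝ) (n : ℕ) :
    (skewOrthogonalPolynomial μ g n).natDegree ≤ n :=
  natDegree_sum_le_of_forall_le _ _ fun k _ => (natDegree_C_mul_X_pow_le _ _).trans k.is_le

theorem coeff_skewOrthogonalPolynomial_self {n : ℕ}
    (hτ : schurMoment μ (fun j : Fin n => g j) ≠ 0) :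
    (skewOrthogonalPolynomial μ g n).coeff n = 1 := by
  rw [skewOrthogonalPolynomial, finsetSum_coeff, Fin.sum_univ_castSucc,
    Finset.sum_eq_zero fun k _ => by
      rw [coeff_C_mul_X_pow, if_neg]; exact (Fin.is_lt k).ne']
  simp only [Fin.val_last, Fin.succAbove_last, Fin.val_castSucc, Even.neg_one_pow ⟨n, rfl⟩,
    one_mul, div_self hτ, coeff_C_mul_X_pow, if_true, zero_add]

variable [SigmaFinite μ] [NullSingletonClass μ]

theorem momentForm_skewOrthogonalPolynomial (hμ : ∀ᵐ x ∂μ, 0 < x) (hg : ∀ k, Integrable (g k) μ)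
    (n i : ℕ) :
    momentForm (fun j k => skewMoment μ (g j) (g k)) (skewOrthogonalPolynomial μ g n) (X ^ i) =
      (schurMoment μ (Fin.snoc (α := fun _ => ℝ → ℝ) (fun j : Fin (n + 1) => g j) (g i)) -
        if Even n then 0 else schurMoment μ (fun j : Fin (n + 1) => g j) * ∫ x, g i x ∂μ) /
      schurMoment μ fun j : Fin n => g j := by
  have hf : ∀ j, Integrable
      (Fin.snoc (α := fun _ => ℝ → ℝ) (fun j : Fin (n + 1) => g j) (g i) j) μ :=
    Fin.lastCases (by simpa only [Fin.snoc_last] using hg i)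
      fun j => by simpa only [Fin.snoc_castSucc] using hg j
  have hsum := sum_schurMoment_succAbove_mul_skewMoment hμ hf
  simp only [Fin.snoc_castSucc, Fin.snoc_last] at hsum
  rw [← hsum, Finset.sum_div, skewOrthogonalPolynomial, map_sum, LinearMap.sum_apply]
  refine Finset.sum_congr rfl fun k _ => ?_
  rw [← smul_eq_C_mul, map_smul, LinearMap.smul_apply, momentForm_X_pow, smul_eq_mul]
  ring

theorem isPartialSkewOrthogonal_skewOrthogonalPolynomial (hμ : ∀ᵐ x ∂μ, 0 < x)
    (hg : ∀ k, Integrable (g k) μ) (hτ : ∀ n, schurMoment μ (fun j : Fin n => g j) ≠ 0) :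
    IsPartialSkewOrthogonal (momentForm fun j k => skewMoment μ (g j) (g k))
      (momentFunctional fun k => ∫ x, g k x ∂μ) (fun n => schurMoment μ fun j : Fin n => g j)
      (skewOrthogonalPolynomial μ g) := by
  have hzero : ∀ {n i}, i ≤ n → schurMoment μ
      (Fin.snoc (α := fun _ => ℝ → ℝ) (fun j : Fin (n + 1) => g j) (g i)) = 0 := fun {n i} hi =>
    schurMoment_eq_zero (Fin.castSucc_lt_last ⟨i, Nat.lt_succ_of_le hi⟩).ne
      (by simp only [Fin.snoc_castSucc, Fin.snoc_last])
  have hsnoc : ∀ n, (Fin.snoc (α := fun _ => ℝ → ℝ) (fun j : Fin (n + 1) => g j) (g (n + 1))) =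
      fun j : Fin (n + 2) => g j := fun n =>
    funext (Fin.lastCases (by simp) fun j => by simp)
  refine ⟨fun n => ?_, fun n => ?_, fun n i hi => ?_, fun n i hi => ?_⟩
  · exact monic_of_natDegree_le_of_coeff_eq_one n (natDegree_skewOrthogonalPolynomial_le μ g n)
      (coeff_skewOrthogonalPolynomial_self (hτ n))
  · refine natDegree_eq_of_le_of_coeff_ne_zero (natDegree_skewOrthogonalPolynomial_le μ g n) ?_
    rw [coeff_skewOrthogonalPolynomial_self (hτ n)]
    exact one_ne_zero
  · rw [momentForm_skewOrthogonalPolynomial hμ hg, if_pos (even_two_mul n), sub_zero]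
    split_ifs with h
    · rw [h, hsnoc]
    · rw [hzero (by omega), zero_div]
  · rw [momentForm_skewOrthogonalPolynomial hμ hg,
      if_neg (Nat.not_even_iff_odd.2 (odd_two_mul_add_one n)), hzero hi, momentFunctional_X_pow]
    ring

end SkewOrthogonalPolynomial

section Laguerre

/-- Lebesgue measure on the positive half-line. -/
abbrev halfLine : Measure ℝ := volume.restrict (Set.Ioi 0)

/-- The weighted monomial `x^(kθ + a) e^{-x}`. -/
def weightedMonomial (a θ : ℝ) (k : ℕ) (x : ℝ) : ℝ := x ^ (k * θ + a) * Real.exp (-x)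

variable {a θ : ℝ}

theorem ae_halfLine_pos : ∀ᵐ x ∂halfLine, 0 < x := ae_restrict_mem measurableSet_Ioi

theorem ae_halfLine_prod_pos : ∀ᵐ z ∂halfLine.prod halfLine, 0 < z.1 ∧ 0 < z.2 := by
  filter_upwards [Measure.quasiMeasurePreserving_fst.ae ae_halfLine_pos,
    Measure.quasiMeasurePreserving_snd.ae ae_halfLine_pos] with z h₁ h₂ using ⟨h₁, h₂⟩

theorem orthant_eq_pi (N : ℕ) : orthant N = Set.univ.pi fun _ => Set.Ioi 0 := by
  ext x
  simp [orthant]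

theorem measurableSet_orthant (N : ℕ) : MeasurableSet (orthant N) :=
  orthant_eq_pi N ▸ MeasurableSet.univ_pi fun _ => measurableSet_Ioi

theorem restrict_orthant (N : ℕ) :
    (volume : Measure (Fin N → ℝ)).restrict (orthant N) = Measure.pi fun _ => halfLine := by
  rw [orthant_eq_pi, volume_pi, Measure.restrict_pi_pi]

theorem restrict_orthant_prod (N : ℕ) :
    (volume : Measure ((Fin N → ℝ) × (Fin N → ℝ))).restrict (orthant N ×ˢ orthant N) =
      (Measure.pi fun _ => halfLine).prod (Measure.pi fun _ => halfLine) := by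
  rw [Measure.volume_eq_prod, ← Measure.prod_restrict, restrict_orthant]

theorem restrict_Ioi_prod :
    (volume : Measure (ℝ × ℝ)).restrict (Set.Ioi 0 ×ˢ Set.Ioi 0) = halfLine.prod halfLine := by
  rw [Measure.volume_eq_prod, Measure.prod_restrict]

theorem weightedMonomial_eq {x : ℝ} (hx : 0 < x) (k : ℕ) :
    weightedMonomial a θ k x = (x ^ θ) ^ k * (x ^ a * Real.exp (-x)) := by
  rw [weightedMonomial, Real.rpow_add hx, mul_comm (k : ℝ) θ, Real.rpow_mul_natCast hx.le,
    mul_assoc]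

theorem weightedMonomial_add_one {x : ℝ} (hx : 0 < x) (k : ℕ) :
    weightedMonomial (a + 1) θ k x = x * weightedMonomial a θ k x := by
  rw [weightedMonomial, weightedMonomial, ← add_assoc, Real.rpow_add_one hx.ne']
  ring

theorem buresMoment_eq_integral (a θ : ℝ) (k : ℕ) :
    buresMoment a θ k = ∫ x, weightedMonomial a θ k x ∂halfLine := rfl

theorem integrable_weightedMonomial (ha : -1 < a) (hθ : 0 < θ) (k : ℕ) :
    Integrable (weightedMonomial a θ k) halfLine := by
  have h : 0 < k * θ + a + 1 := by
    have : 0 ≤ k * θ := by positivity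
    linarith
  refine (Real.GammaIntegral_convergent h).congr (Filter.Eventually.of_forall fun x => ?_)
  simp [weightedMonomial, mul_comm]

theorem det_weightedMonomial {N : ℕ} {x : Fin N → ℝ} (hx : ∀ i, 0 < x i) :
    (Matrix.of fun k j : Fin N => weightedMonomial a θ k (x j)).det =
      (∏ j, ∏ k ∈ Finset.Ioi j, (x k ^ θ - x j ^ θ)) * ∏ j, x j ^ a * Real.exp (-x j) := by
  have h : (Matrix.of fun k j : Fin N => weightedMonomial a θ k (x j)) =
      (Matrix.vandermonde fun j => x j ^ θ).transpose *
        Matrix.diagonal fun j => x j ^ a * Real.exp (-x j) := by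
    ext k j
    rw [Matrix.mul_diagonal, Matrix.of_apply, weightedMonomial_eq (hx j)]
    rfl
  rw [h, Matrix.det_mul, Matrix.det_transpose, Matrix.det_vandermonde, Matrix.det_diagonal]

theorem bures_integrand_eq {N : ℕ} {x : Fin N → ℝ} (hx : ∀ i, 0 < x i) :
    (∏ j, ∏ k ∈ Finset.Ioi j, (x k - x j) / (x k + x j) * (x k ^ θ - x j ^ θ)) *
      ∏ j, x j ^ a * Real.exp (-x j) =
    schurProd x * (Matrix.of fun k j : Fin N => weightedMonomial a θ k (x j)).det := by
  rw [det_weightedMonomial hx]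
  simp only [Finset.prod_mul_distrib, schurProd, skewKernel]
  ring

theorem bures_integrand_pos (a : ℝ) (hθ : 0 < θ) {N : ℕ} {x : Fin N → ℝ} (hx : ∀ i, 0 < x i)
    (hinj : Function.Injective x) :
    0 < (∏ j, ∏ k ∈ Finset.Ioi j, (x k - x j) / (x k + x j) * (x k ^ θ - x j ^ θ)) *
      ∏ j, x j ^ a * Real.exp (-x j) := by
  refine mul_pos (Finset.prod_pos fun j _ => Finset.prod_pos fun k hk => ?_)
    (Finset.prod_pos fun j _ => mul_pos (Real.rpow_pos_of_pos (hx j) a) (Real.exp_pos _))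
  rw [div_mul_eq_mul_div]
  refine div_pos ?_ (add_pos (hx k) (hx j))
  rcases lt_or_gt_of_ne (hinj.ne (Finset.mem_Ioi.1 hk).ne) with hlt | hgt
  · exact mul_pos (sub_pos.2 hlt) (sub_pos.2 (Real.rpow_lt_rpow (hx j).le hlt hθ))
  · exact mul_pos_of_neg_of_neg (sub_neg.2 hgt) (sub_neg.2 (Real.rpow_lt_rpow (hx k).le hgt hθ))

theorem factorial_mul_buresPartition (a θ : ℝ) (N : ℕ) :
    N.factorial * buresPartition a θ N =
      ∫ x, schurProd x * (Matrix.of fun k j : Fin N => weightedMonomial a θ k (x j)).det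
        ∂(Measure.pi fun _ => halfLine) := by
  have hN : (N.factorial : ℝ) ≠ 0 := by positivity
  rw [buresPartition, ← mul_assoc, mul_one_div_cancel hN, one_mul,
    setIntegral_congr_fun (measurableSet_orthant N) fun x hx => bures_integrand_eq hx,
    restrict_orthant]

theorem buresPartition_eq_schurMoment (ha : -1 < a) (hθ : 0 < θ) (N : ℕ) :
    buresPartition a θ N = schurMoment halfLine fun j : Fin N => weightedMonomial a θ j := by
  have hN : (N.factorial : ℝ) ≠ 0 := by positivity
  rw [← mul_right_inj' hN, factorial_mul_buresPartition, integral_schurProd_mul_det ae_halfLine_pos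
    fun j : Fin N => integrable_weightedMonomial ha hθ j]

theorem buresPartition_pos (ha : -1 < a) (hθ : 0 < θ) (N : ℕ) : 0 < buresPartition a θ N := by
  have hN : (0 : ℝ) < N.factorial := by positivity
  set F : (Fin N → ℝ) → ℝ := fun x =>
    schurProd x * (Matrix.of fun k j : Fin N => weightedMonomial a θ k (x j)).det
  have hF_int : Integrable F (Measure.pi fun _ => halfLine) :=
    integrable_schurProd_mul_det ae_halfLine_pos fun j => integrable_weightedMonomial ha hθ j
  have hF_pos : ∀ᵐ x ∂(Measure.pi fun _ => halfLine), 0 < F x := by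
    filter_upwards [ae_pi_pos ae_halfLine_pos N, ae_pi_injective halfLine N] with x hx hinj
    exact (bures_integrand_pos a hθ hx hinj).trans_eq (bures_integrand_eq hx)
  have : NeZero (Measure.pi fun _ : Fin N => halfLine) :=
    ⟨fun h => by simpa [Measure.pi_univ] using congrArg (· Set.univ) h⟩
  rw [← mul_pos_iff_of_pos_left hN, factorial_mul_buresPartition]
  refine (integral_nonneg_of_ae (hF_pos.mono fun _ => le_of_lt)).lt_of_ne' fun h => ?_
  rw [integral_eq_zero_iff_of_nonneg_ae (hF_pos.mono fun _ => le_of_lt) hF_int] at h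
  obtain ⟨x, hx_pos, hx_zero⟩ := (hF_pos.and h).exists
  exact hx_pos.ne' hx_zero

/-- The bilinear extension of the Bures inner product of monomials. -/
def buresForm (a θ : ℝ) : LinearMap.BilinForm ℝ ℝ[X] :=
  momentForm fun j k => skewMoment halfLine (weightedMonomial a θ j) (weightedMonomial a θ k)

theorem isAlt_buresForm (a θ : ℝ) : (buresForm a θ).IsAlt :=
  isAlt_momentForm fun _ _ => skewMoment_swap _ _

theorem buresInner_X_pow (ha : -1 < a) (hθ : 0 < θ) (p : ℝ[X]) (i : ℕ) :
    buresInner a θ p (X ^ i) = buresForm a θ p (X ^ i) := by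
  have hsum := linearMap_apply_eq_sum_coeff ((buresForm a θ).flip (X ^ i)) le_rfl (p := p)
  simp only [LinearMap.BilinForm.flip_apply, buresForm, momentForm_X_pow] at hsum
  rw [buresForm, hsum, buresInner, restrict_Ioi_prod]
  simp only [skewMoment, ← integral_const_mul]
  rw [← integral_finsetSum _ fun (k : Fin (p.natDegree + 1)) _ =>
    (integrable_skewKernel_mul ae_halfLine_pos (integrable_weightedMonomial ha hθ k)
      (integrable_weightedMonomial ha hθ i)).const_mul _]
  refine integral_congr_ae ?_
  filter_upwards [ae_halfLine_prod_pos] with z hz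
  rw [eval_eq_sum_range, Finset.sum_range, Finset.mul_sum]
  simp only [Finset.sum_mul]
  refine Finset.sum_congr rfl fun k _ => ?_
  rw [weightedMonomial_eq hz.1, weightedMonomial_eq hz.2, skewKernel, neg_add, Real.exp_add,
    eval_pow, eval_X]
  ring

theorem isThetaBures_iff (ha : -1 < a) (hθ : 0 < θ) {φ : ℕ → ℝ[X]} :
    IsThetaBures a θ φ ↔ IsPartialSkewOrthogonal (buresForm a θ)
      (momentFunctional (buresMoment a θ)) (buresPartition a θ) φ := by
  constructor
  · rintro ⟨hmonic, hdeg, heven, hodd⟩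
    simp only [buresInner_X_pow ha hθ, ← momentFunctional_X_pow (buresMoment a θ)] at heven hodd
    exact ⟨hmonic, hdeg, heven, hodd⟩
  · rintro ⟨hmonic, hdeg, heven, hodd⟩
    simp only [← buresInner_X_pow ha hθ, momentFunctional_X_pow] at heven hodd
    exact ⟨hmonic, hdeg, heven, hodd⟩

theorem existsUnique_isThetaBures (ha : -1 < a) (hθ : 0 < θ) :
    ∃! φ : ℕ → ℝ[X], IsThetaBures a θ φ := by
  have hτ := fun n => (buresPartition_pos ha hθ n).ne'
  have hexists : IsThetaBures a θ (skewOrthogonalPolynomial halfLine (weightedMonomial a θ)) := by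
    have h := isPartialSkewOrthogonal_skewOrthogonalPolynomial ae_halfLine_pos
      (integrable_weightedMonomial ha hθ)
      fun n => buresPartition_eq_schurMoment ha hθ n ▸ hτ n
    simp only [← buresPartition_eq_schurMoment ha hθ] at h
    exact (isThetaBures_iff ha hθ).2 h
  exact ⟨_, hexists, fun φ hφ => ((isThetaBures_iff ha hθ).1 hφ).unique
    ((isThetaBures_iff ha hθ).1 hexists) (isAlt_buresForm a θ) hτ⟩

end Laguerre

section CauchyLaguerre

variable {a b θ : ℝ}

theorem cauchy_integrand_eq {N : ℕ} {x y : Fin N → ℝ} (hx : ∀ i, 0 < x i) (hy : ∀ i, 0 < y i) :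
    (∏ j, x j ^ a * Real.exp (-x j) * (y j ^ b * Real.exp (-y j))) *
      ((∏ j, ∏ k ∈ Finset.Ioi j, (x k - x j) * (y k - y j)) / ∏ j, ∏ k, (x j + y k)) *
      (∏ j, ∏ k ∈ Finset.Ioi j, (x k ^ θ - x j ^ θ) * (y k ^ θ - y j ^ θ)) =
    (Matrix.of fun j k => (x j + y k)⁻¹).det *
      (Matrix.of fun k j : Fin N => weightedMonomial a θ k (x j)).det *
      (Matrix.of fun k j : Fin N => weightedMonomial b θ k (y j)).det := by
  rw [det_cauchy fun j k => (add_pos (hx j) (hy k)).ne', det_weightedMonomial hx,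
    det_weightedMonomial hy, Matrix.det_vandermonde, Matrix.det_vandermonde]
  simp only [Finset.prod_mul_distrib]
  ring

theorem cauchyPartition_eq_det {N : ℕ} (hint : ∀ j k : Fin N, Integrable (fun z : ℝ × ℝ =>
      (z.1 + z.2)⁻¹ * weightedMonomial a θ j z.1 * weightedMonomial b θ k z.2)
      (halfLine.prod halfLine)) :
    cauchyPartition a b θ N = (Matrix.of fun j k : Fin N =>
      ∫ z, (z.1 + z.2)⁻¹ * weightedMonomial a θ j z.1 * weightedMonomial b θ k z.2
        ∂(halfLine.prod halfLine)).det := by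
  have hN : (N.factorial : ℝ) ≠ 0 := by positivity
  rw [cauchyPartition, setIntegral_congr_fun
    ((measurableSet_orthant N).prod (measurableSet_orthant N))
    fun z hz => cauchy_integrand_eq hz.1 hz.2, restrict_orthant_prod,
    integral_det_mul_det_mul_det (H := fun x y => (x + y)⁻¹) hint, Fintype.card_fin,
    ← mul_assoc, ← mul_pow, one_div_mul_cancel hN, one_pow, one_mul]

theorem inv_add_mul_weightedMonomial {x y : ℝ} (hx : 0 < x) (hy : 0 < y) (j k : ℕ) :
    (x + y)⁻¹ * weightedMonomial a θ j x * weightedMonomial (a + 1) θ k y =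
      2⁻¹ * (weightedMonomial a θ j x * weightedMonomial a θ k y +
        skewKernel x y * (weightedMonomial a θ j x * weightedMonomial a θ k y)) := by
  rw [weightedMonomial_add_one hy, skewKernel]
  have := (add_pos hx hy).ne'
  have := (add_pos hy hx).ne'
  field_simp
  ring

theorem integrable_inv_add_mul_weightedMonomial (ha : -1 < a) (hθ : 0 < θ) (j k : ℕ) :
    Integrable (fun z : ℝ × ℝ =>
      (z.1 + z.2)⁻¹ * weightedMonomial a θ j z.1 * weightedMonomial (a + 1) θ k z.2)
      (halfLine.prod halfLine) := by
  have hj := integrable_weightedMonomial ha hθ j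
  have hk := integrable_weightedMonomial ha hθ k
  refine (((hj.mul_prod hk).add (integrable_skewKernel_mul ae_halfLine_pos hj hk)).const_mul
    2⁻¹).congr ?_
  filter_upwards [ae_halfLine_prod_pos] with z hz
  exact (inv_add_mul_weightedMonomial hz.1 hz.2 j k).symm

theorem integral_inv_add_mul_weightedMonomial (ha : -1 < a) (hθ : 0 < θ) (j k : ℕ) :
    ∫ z, (z.1 + z.2)⁻¹ * weightedMonomial a θ j z.1 * weightedMonomial (a + 1) θ k z.2
      ∂(halfLine.prod halfLine) =
    cauchyForm (momentFunctional (buresMoment a θ)) (buresForm a θ) (X ^ j) (X ^ k) := by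
  have hj := integrable_weightedMonomial ha hθ j
  have hk := integrable_weightedMonomial ha hθ k
  rw [cauchyForm_apply, momentFunctional_X_pow, momentFunctional_X_pow, buresForm, momentForm_X_pow,
    skewMoment, buresMoment_eq_integral, buresMoment_eq_integral, ← integral_prod_mul,
    ← integral_add (hj.mul_prod hk) (integrable_skewKernel_mul ae_halfLine_pos hj hk),
    ← integral_const_mul]
  refine integral_congr_ae ?_
  filter_upwards [ae_halfLine_prod_pos] with z hz
  exact inv_add_mul_weightedMonomial hz.1 hz.2 j k

theorem cauchyMoment_eq_cauchyForm (ha : -1 < a) (hθ : 0 < θ) (j k : ℕ) :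
    cauchyMoment a θ j k =
      cauchyForm (momentFunctional (buresMoment a θ)) (buresForm a θ) (X ^ j) (X ^ k) := by
  rw [← integral_inv_add_mul_weightedMonomial ha hθ, cauchyMoment, restrict_Ioi_prod]
  congr 1 with z
  rw [weightedMonomial, weightedMonomial, neg_add, Real.exp_add, one_div, ← add_assoc]
  ring

theorem cauchyPartition_eq_det_monomialGram (ha : -1 < a) (hθ : 0 < θ) (n : ℕ) :
    cauchyPartition a (a + 1) θ n =
      (monomialGram (cauchyForm (momentFunctional (buresMoment a θ)) (buresForm a θ)) n).det := by
  rw [cauchyPartition_eq_det fun j k => integrable_inv_add_mul_weightedMonomial ha hθ j k]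
  simp only [integral_inv_add_mul_weightedMonomial ha hθ, monomialGram]

theorem cauchyP_eq_cauchyPolynomial (ha : -1 < a) (hθ : 0 < θ) {φ : ℕ → ℝ[X]}
    (hφ : IsThetaBures a θ φ) (n : ℕ) :
    cauchyP a θ n = cauchyPolynomial (buresPartition a θ) φ 1 n := by
  rw [isThetaBures_iff ha hθ] at hφ
  have hτ := fun n => (buresPartition_pos ha hθ n).ne'
  have hbordered := hφ.det_bordered_cauchyForm (isAlt_buresForm a θ) hτ (one_mul 1) n
  have hgram := hφ.det_monomialGram_cauchyForm_ne_zero (isAlt_buresForm a θ) hτ (one_mul 1) n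
  rw [one_smul] at hbordered hgram
  simp only [cauchyP, cauchyMoment_eq_cauchyForm ha hθ]
  rw [cauchyPartition_eq_det_monomialGram ha hθ, hbordered, ← mul_assoc, ← C_mul,
    inv_mul_cancel₀ hgram, C_1, one_mul]

theorem cauchyQ_eq_cauchyPolynomial (ha : -1 < a) (hθ : 0 < θ) {φ : ℕ → ℝ[X]}
    (hφ : IsThetaBures a θ φ) (n : ℕ) :
    cauchyQ a θ n = cauchyPolynomial (buresPartition a θ) φ (-1) n := by
  rw [isThetaBures_iff ha hθ] at hφ
  have hB := isAlt_buresForm a θ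
  have hτ := fun n => (buresPartition_pos ha hθ n).ne'
  have hε : (-1 : ℝ) * -1 = 1 := by norm_num
  have hbordered := hφ.det_bordered_cauchyForm hB hτ hε n
  have hgram := hφ.det_monomialGram_cauchyForm_ne_zero hB hτ hε n
  rw [← flip_cauchyForm hB, det_monomialGram_flip] at hbordered hgram
  simp only [LinearMap.BilinForm.flip_apply] at hbordered
  simp only [cauchyQ, cauchyMoment_eq_cauchyForm ha hθ]
  rw [cauchyPartition_eq_det_monomialGram ha hθ, ← Matrix.det_transpose (Matrix.of _)]
  refine (congrArg (C _ * ·) hbordered).trans ?_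
  rw [← mul_assoc, ← C_mul, inv_mul_cancel₀ hgram, C_1, one_mul]

end CauchyLaguerre

end ThetaDeformed

end

theorem mainTheorem11 (a θ : ℝ) (ha : -1 < a) (hθ : 0 < θ) :
    (∃! φ : ℕ → ℝ[X], ThetaDeformed.IsThetaBures a θ φ) ∧
    ∀ φ : ℕ → ℝ[X], ThetaDeformed.IsThetaBures a θ φ →
      (∀ n : ℕ,
        ThetaDeformed.cauchyP a θ n + ThetaDeformed.cauchyQ a θ n = 2 * φ n) ∧
      (∀ n : ℕ, 1 ≤ n →
        ThetaDeformed.cauchyQ a θ n =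
          φ n - C (ThetaDeformed.buresPartition a θ (n + 1) *
            ThetaDeformed.buresPartition a θ (n - 1) /
              ThetaDeformed.buresPartition a θ n ^ 2) * φ (n - 1)) ∧
      (∀ n : ℕ, 1 ≤ n →
        ThetaDeformed.cauchyP a θ n =
          φ n + C (ThetaDeformed.buresPartition a θ (n + 1) *
            ThetaDeformed.buresPartition a θ (n - 1) /
              ThetaDeformed.buresPartition a θ n ^ 2) * φ (n - 1)) := by
  refine ⟨ThetaDeformed.existsUnique_isThetaBures ha hθ, fun φ hφ => ?_⟩
  simp only [ThetaDeformed.cauchyP_eq_cauchyPolynomial ha hθ hφ,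
    ThetaDeformed.cauchyQ_eq_cauchyPolynomial ha hθ hφ]
  refine ⟨ThetaDeformed.cauchyPolynomial_add_cauchyPolynomial_neg _ φ 1, fun n hn => ?_,
    fun n hn => ?_⟩
  all_goals
    obtain ⟨m, rfl⟩ := Nat.exists_eq_add_of_le' hn
    simp [ThetaDeformed.cauchyPolynomial, sub_eq_add_neg]
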